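/- Let $\rho$ be an $n$-qubit density matrix of rank $\kappa\le 2^n$, let $S(\rho)=-\operatorname{tr}(\rho\ln\rho)$ be its von Neumann entropy, and let $U_\rho$ be a purified quantum query oracle of $\rho$, that is, a unitary on $n+n'$ qubits such that $|\Psi\rangle_{AB}=U_\rho|0^{n}\rangle_A|0^{n'}\rangle_B$ satisfies $\operatorname{tr}_B|\Psi\rangle\langle\Psi|=\rho$. A query circuit consists of oracle-independent unitary gates on an ancilla register together with $AB$ and of applications of $U_\rho$ and $U_\rho^\dagger$ to $AB$ (the queries), and it starts in the all-zero state. For every $\varepsilon_0\in(0,1)$ and every failure probability $\delta\in(0,1)$ there is a constant $C>0$ such that for all $n,n'\ge 0$, all $1\le\kappa\le 2^n$ and all $0<\varepsilon\le\varepsilon_0$ there is a query circuit $\mathcal A$, depending only on $n,n',\kappa,\varepsilon,\varepsilon_0,\delta$, with the following two properties for every $\rho$ of rank $\kappa$ and every purified oracle $U_\rho$ of $\rho$. 1. For some number of repetitions, running $\mathcal A$ repeatedly, measuring only its first qubit in the computational basis after each run, and classically processing the outcomes yields with probability at least $1-\delta$ an estimate of $S(\rho)$ with error at most $\varepsilon$.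 The total number of queries to $U_\rho$ and $U_\rho^\dagger$ is at most $C\,\frac{\kappa}{\varepsilon^3}\log^3\!\left(\frac{\kappa}{\varepsilon}\right)\log\!\left(\frac1\varepsilon\right)$. 2. Let $G=\mathcal A\,(2|0\rangle\langle 0|-I)\,\mathcal A^\dagger\,\bigl((I-2|1\rangle\langle 1|)\otimes I\bigr)$ be the Grover operator of $\mathcal A$, where $|1\rangle\langle 1|$ acts on the first qubit. For some $t$ and some number of repetitions, running amplitude estimation of $\mathcal A$ (phase estimation of $G$ on $\mathcal A|0\rangle$ with a control register of $t$ qubits, by the quantum Fourier transform), measuring the control register after each run, and classically processing the outcomes yields with probability at least $1-\delta$ an estimate of $S(\rho)$ with error at most $\varepsilon$. The total number of queries to $U_\rho$ and $U_\rho^\dagger$ is at most $C\,\frac{\kappa}{\varepsilon^2}\log^2\!\left(\frac{\kappa}{\varepsilon}\right)\log\!\left(\frac1\varepsilon\right)$. In both parts the numbers of repetitions, $t$ and the classical processing also depend only on $n,n',\kappa,\varepsilon,\varepsilon_0,\delta$. -/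

import Mathlib

open scoped Kronecker ComplexOrder

namespace QPP

noncomputable section

/-! ### States, purified query oracles, von Neumann entropy -/

/-- Index set of the computational basis of a register of `k` qubits; `0` is `|0…0⟩`. -/
abbrev Reg (k : ℕ) : Type := Fin (2 ^ k)

/-- Density matrices: positive semidefinite with trace one. -/
def IsDensityMatrix {ι : Type} [Fintype ι] (ρ : Matrix ι ι ℂ) : Prop :=
  ρ.PosSemidef ∧ ρ.trace = 1

/-- The partial trace over the second tensor factor. -/
def partialTraceB {A B : Type} [Fintype B] (M : Matrix (A × B) (A × B) ℂ) : Matrix A A ℂ :=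
  fun i j => ∑ b, M (i, b) (j, b)

/-- `U` is a purified quantum query oracle of `ρ`: the state `|Ψ⟩ = U |0⟩_A |0⟩_B` is a purification
of `ρ`, that is, `tr_B |Ψ⟩⟨Ψ| = ρ`. Here `A` has `n` qubits and `B` has `n'` qubits. -/
def IsPurifiedOracle {n n' : ℕ} (U : Matrix.unitaryGroup (Reg n × Reg n') ℂ)
    (ρ : Matrix (Reg n) (Reg n) ℂ) : Prop :=
  let Ψ : Reg n × Reg n' → ℂ := fun x => U.1 x 0
  partialTraceB (Matrix.vecMulVec Ψ (star Ψ)) = ρ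

/-- The von Neumann entropy `S(ρ) = - tr (ρ ln ρ)`; `ln ρ` is taken by functional calculus, and
`Real.log 0 = 0` realizes the convention `0 ln 0 = 0`. -/
def vonNeumannEntropy {ι : Type} [Fintype ι] [DecidableEq ι] (ρ : Matrix ι ι ℂ) : ℝ :=
  -((ρ * cfc Real.log ρ).trace).re

/-! ### Quantum query circuits -/

/-- One step of a query circuit with workspace `W` and oracle register `O`: a unitary on everything
that does not depend on the oracle, or an application of the oracle or of its inverse to `O`. -/
inductive Step (W O : Type) [Fintype W] [DecidableEq W] [Fintype O] [DecidableEq O] : Type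
  | gate (V : Matrix.unitaryGroup (W × O) ℂ) : Step W O
  | query : Step W O
  | queryInv : Step W O

/-- A query circuit; the head of the list is applied first. -/
abbrev Circuit (W O : Type) [Fintype W] [DecidableEq W] [Fintype O] [DecidableEq O] : Type :=
  List (Step W O)

section Circuits

variable {W O : Type} [Fintype W] [DecidableEq W] [Fintype O] [DecidableEq O]

/-- The operator of a step when the oracle is `U`. -/
def Step.eval (U : Matrix.unitaryGroup O ℂ) : Step W O → Matrix (W × O) (W × O) ℂ
  | .gate V => V.1
  | .query => (1 : Matrix W W ℂ) ⊗ₖ U.1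
  | .queryInv => (1 : Matrix W W ℂ) ⊗ₖ (star U).1

/-- The number of oracle queries of a step. -/
def Step.cost : Step W O → ℕ
  | .gate _ => 0
  | .query => 1
  | .queryInv => 1

/-- The inverse of a step. -/
def Step.inv : Step W O → Step W O
  | .gate V => .gate (star V)
  | .query => .queryInv
  | .queryInv => .query

/-- The operator of a circuit when the oracle is `U`. -/
def Circuit.eval (U : Matrix.unitaryGroup O ℂ) : Circuit W O → Matrix (W × O) (W × O) ℂ
  | [] => 1
  | s :: c => Circuit.eval U c * s.eval U

/-- The number of queries to the oracle and to its inverse made by one execution of a circuit. -/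
def Circuit.queries (c : Circuit W O) : ℕ := (c.map Step.cost).sum

/-- The inverse circuit. -/
def Circuit.inv (c : Circuit W O) : Circuit W O := (c.map Step.inv).reverse

end Circuits

/-- Run the circuit from the all-zero basis state and measure the first workspace register `R` in
the computational basis: the Born probability of the outcome `r`. -/
def outcomeProb {R W O : Type} [Fintype R] [DecidableEq R] [Fintype W] [DecidableEq W]
    [Fintype O] [DecidableEq O] [Zero R] [Zero W] [Zero O]
    (c : Circuit (R × W) O) (U : Matrix.unitaryGroup O ℂ) (r : R) : ℝ :=
  ∑ w : W, ∑ o : O, ‖Circuit.eval U c ((r, w), o) 0‖ ^ 2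

open Classical in
/-- The probability of an event about the results of `M` independent executions of an experiment
whose single outcome has the probability function `p`. -/
def iidProb {R : Type} [Fintype R] (M : ℕ) (p : R → ℝ) (E : (Fin M → R) → Prop) : ℝ :=
  ∑ x : Fin M → R, if E x then ∏ i, p (x i) else 0

/-! ### Amplitude estimation -/

section AmplitudeEstimation

/-- The diagonal unitary that flips the sign of the basis states on which `s` holds. -/
def signGate {ι : Type} [Fintype ι] [DecidableEq ι] (s : ι → Prop) [DecidablePred s] :
    Matrix.unitaryGroup ι ℂ :=
  ⟨Matrix.diagonal fun x => if s x then -1 else 1, by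
    rw [Matrix.mem_unitaryGroup_iff, Matrix.star_eq_conjTranspose, Matrix.diagonal_conjTranspose,
      Matrix.diagonal_mul_diagonal, ← Matrix.diagonal_one]
    congr 1
    funext x
    by_cases h : s x <;> simp [h]⟩

/-- The matrix of the quantum Fourier transform of order `N`. -/
def fourierMatrix (N : ℕ) : Matrix (Fin N) (Fin N) ℂ := fun x y =>
  Complex.exp (2 * Real.pi * Complex.I * ((x : ℕ) * (y : ℕ) : ℂ) / N) / (Real.sqrt N : ℂ)

theorem fourierMatrix_mem (N : ℕ) : fourierMatrix N ∈ Matrix.unitaryGroup (Fin N) ℂ := by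
  rcases Nat.eq_zero_or_pos N with rfl | hN
  · rw [Matrix.mem_unitaryGroup_iff]
    ext x
    exact x.elim0
  have hN' : (N : ℂ) ≠ 0 := by exact_mod_cast hN.ne'
  have hsq : (Real.sqrt N : ℂ) * (Real.sqrt N : ℂ) = N := by
    rw [← Complex.ofReal_mul, Real.mul_self_sqrt (Nat.cast_nonneg N)]
    simp
  rw [Matrix.mem_unitaryGroup_iff]
  ext x y
  set r : ℂ := Complex.exp (2 * Real.pi * Complex.I * (((x : ℕ) : ℂ) - ((y : ℕ) : ℂ)) / N) with hr
  have hterm : ∀ z : Fin N, fourierMatrix N x z * star (fourierMatrix N) z y = r ^ (z : ℕ) / N := by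
    intro z
    rw [Matrix.star_apply, fourierMatrix, fourierMatrix, hr, ← Complex.exp_nat_mul, star_div₀,
      div_mul_div_comm]
    simp only [RCLike.star_def, Complex.conj_ofReal, ← Complex.exp_conj]
    rw [← Complex.exp_add, hsq]
    congr 2
    simp only [map_div₀, map_mul, Complex.conj_ofReal, Complex.conj_I, map_natCast, map_ofNat]
    ring
  rw [Matrix.mul_apply, Finset.sum_congr rfl fun z _ => hterm z, ← Finset.sum_div,
    Fin.sum_univ_eq_sum_range (fun k => r ^ k) N]
  by_cases hxy : x = y
  · subst hxy
    have h1 : r = 1 := by simp [hr]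
    simp [h1, hN']
  · have hrN : r ^ N = 1 := by
      rw [hr, ← Complex.exp_nat_mul, Complex.exp_eq_one_iff]
      refine ⟨((x : ℕ) : ℤ) - ((y : ℕ) : ℤ), ?_⟩
      push_cast
      field_simp
    have hr1 : r ≠ 1 := by
      intro h
      rw [hr, Complex.exp_eq_one_iff] at h
      obtain ⟨k, hk⟩ := h
      have h2 : (2 * Real.pi * Complex.I : ℂ) ≠ 0 := Complex.two_pi_I_ne_zero
      have h3 : (((x : ℕ) : ℂ) - ((y : ℕ) : ℂ)) = k * N := by
        field_simp at hk
        have := mul_left_cancel₀ h2 (a := (2 * Real.pi * Complex.I : ℂ))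
          (b := (((x : ℕ) : ℂ) - ((y : ℕ) : ℂ))) (c := k * N)
          (by linear_combination (2 * Real.pi * Complex.I : ℂ) * hk)
        exact this
      have h4 : ((x : ℕ) : ℤ) - ((y : ℕ) : ℤ) = k * N := by exact_mod_cast h3
      have hx := x.2
      have hy := y.2
      have h5 : k = 0 := by
        by_contra hk0
        have : (N : ℤ) ≤ |((x : ℕ) : ℤ) - ((y : ℕ) : ℤ)| := by
          rw [h4, abs_mul, Nat.abs_cast]
          have : 1 ≤ |k| := Int.one_le_abs hk0
          nlinarith
        have h6 : |((x : ℕ) : ℤ) - ((y : ℕ) : ℤ)| < N := by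
          rw [abs_lt]
          constructor <;> omega
        omega
      rw [h5] at h4
      apply hxy
      ext
      omega
    have hgeom : (∑ k ∈ Finset.range N, r ^ k) = 0 := by
      rw [geom_sum_eq hr1, hrN]
      simp
    simp [hgeom, Matrix.one_apply_ne hxy]

/-- The quantum Fourier transform of order `N`. -/
def fourier (N : ℕ) : Matrix.unitaryGroup (Fin N) ℂ := ⟨fourierMatrix N, fourierMatrix_mem N⟩

variable {R W O : Type} [Fintype R] [DecidableEq R] [Fintype W] [DecidableEq W]
  [Fintype O] [DecidableEq O]

/-- A unitary on the register `R`, acting on the whole system. -/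
def onControl (V : Matrix.unitaryGroup R ℂ) : Matrix.unitaryGroup ((R × W) × O) ℂ :=
  ⟨(V.1 ⊗ₖ (1 : Matrix W W ℂ)) ⊗ₖ (1 : Matrix O O ℂ),
    Matrix.kronecker_mem_unitary (Matrix.kronecker_mem_unitary V.2 (one_mem _)) (one_mem _)⟩

/-- A unitary on `W × O`, acting on the system extended by the register `R`. -/
def extendGate (R : Type) [Fintype R] [DecidableEq R] (V : Matrix.unitaryGroup (W × O) ℂ) :
    Matrix.unitaryGroup ((R × W) × O) ℂ :=
  ⟨((1 : Matrix R R ℂ) ⊗ₖ V.1).submatrix (Equiv.prodAssoc R W O) (Equiv.prodAssoc R W O), by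
    have h := Matrix.kronecker_mem_unitary (one_mem (Matrix.unitaryGroup R ℂ)) V.2
    rw [Matrix.mem_unitaryGroup_iff, Matrix.star_eq_conjTranspose] at h ⊢
    rw [Matrix.conjTranspose_submatrix, Matrix.submatrix_mul_equiv, h,
      Matrix.submatrix_one_equiv]⟩

/-- The same step on the system extended by the register `R`. -/
def Step.extend (R : Type) [Fintype R] [DecidableEq R] : Step W O → Step (R × W) O
  | .gate V => .gate (extendGate R V)
  | .query => .query
  | .queryInv => .queryInv

/-- The same circuit on the system extended by the register `R`. -/
def Circuit.extend (R : Type) [Fintype R] [DecidableEq R] (c : Circuit W O) : Circuit (R × W) O :=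
  c.map (Step.extend R)

variable [Zero W] [Zero O]

/-- For a circuit `𝒜` whose first qubit is the flag, the Grover operator
`G = 𝒜 (2|0⟩⟨0| - I) 𝒜⁻¹ ((I - 2|1⟩⟨1|) ⊗ I)`, applied if the control register is in a basis state
`|j⟩` with `i < j`. Only the two reflections are controlled; for `j ≤ i` the circuit and its inverse
cancel. -/
def controlledGrover (N : ℕ) (c : Circuit (Fin 2 × W) O) (i : ℕ) :
    Circuit (Fin N × (Fin 2 × W)) O :=
  [Step.gate (signGate fun x => i < (x.1.1 : ℕ) ∧ x.1.2.1 = 1)]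
    ++ Circuit.extend (Fin N) (Circuit.inv c)
    ++ [Step.gate (signGate fun x => i < (x.1.1 : ℕ) ∧ ¬ (x.1.2 = 0 ∧ x.2 = 0))]
    ++ Circuit.extend (Fin N) c

/-- Amplitude estimation of the circuit `𝒜` with a control register of `t` qubits, `N = 2 ^ t`:
put the control register into the uniform superposition, prepare `𝒜|0⟩`, apply the power `G ^ j` of
the Grover operator controlled on `|j⟩`, `0 ≤ j < N`, and apply the inverse Fourier transform to the
control register, which is then to be measured. -/
def amplitudeEstimation (t : ℕ) (c : Circuit (Fin 2 × W) O) :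
    Circuit (Reg t × (Fin 2 × W)) O :=
  [Step.gate (onControl (fourier (2 ^ t)))]
    ++ Circuit.extend (Reg t) c
    ++ (List.range (2 ^ t - 1)).flatMap (controlledGrover (2 ^ t) c)
    ++ [Step.gate (onControl (star (fourier (2 ^ t))))]

end AmplitudeEstimation

end

end QPP

/-! The entropy is a combination of traces of Chebyshev polynomials. The real part of `-log (1 - r
e^{iφ})` is `∑ r^k cos (k φ) / k`. With `cos φ = 1 - 2x²` one has `|1 - r e^{iφ}|² = (1 - r)² + 4 r
x²`, which is close to `4x²` for `r` near 1. Hence `-log (2x) ≈ ∑_{k ≤ D} (r^k / k) T_k(1 - 2x²)`.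
Weighting by the eigenvalues `x` of `ρ` and summing gives `S(ρ) ≈ log 2 + ∑ (r^k / k) tr (ρ T_k(1 -
2ρ²))`. The pointwise error `(1 - r) / x` is multiplied by `x`, so each nonzero eigenvalue costs
only `1 - r`, together `κ (1 - r)`. The tail has weight `tr ρ = 1`. With `1 - r = ε / (4κ)`, about
`(κ / ε) log (1 / ε)` terms suffice (`abs_chebyshev_sum_sub_entropy_le`).

The traces come from qubitization. The oracle, an exchange of `A` with a copy of it, and the inverse
oracle form a self-inverse block encoding of `ρ`. A reflection conjugated by it is self-inverse and
encodes `1 - 2ρ²`, so the powers of the associated walk encode `T_k(1 - 2ρ²)` (`walk_pow_eq`). The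
expectation of such a power in the purification is the wanted trace. A Hadamard test on a
superposition of all `k`, with weights `r^k / (k Λ)`, has a flag probability `p` for which `log 2 +
Λ (1 - 2p)` is the approximate entropy. The normalisation `Λ` is at most `log (4κ / ε)`
(`exists_entropy_circuit`).

It remains to find `p` up to order `ε / log (4κ / ε)`. Relative frequencies do this by Chebyshev's
inequality. Amplitude estimation does it with the square root of that number of repetitions, because
its outcome distribution is an average of two Fejér kernels with small tails
(`amplitudeEstimation_concentration`). Both costs are one logarithm `log (κ / ε)` better than
required, and the constant absorbs the difference since `ε ≤ ε₀ < 1`. -/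

namespace QPP

open Matrix

/-! ### Evaluation, inversion and query count of circuits -/

section Circuits

variable {W O : Type} [Fintype W] [DecidableEq W] [Fintype O] [DecidableEq O]

theorem Step.eval_mem (U : Matrix.unitaryGroup O ℂ) (s : Step W O) :
    s.eval U ∈ Matrix.unitaryGroup (W × O) ℂ := by
  cases s with
  | gate V => exact V.2
  | query => exact Matrix.kronecker_mem_unitary (one_mem _) U.2
  | queryInv => exact Matrix.kronecker_mem_unitary (one_mem _) (star U).2

theorem Circuit.eval_mem (U : Matrix.unitaryGroup O ℂ) (c : Circuit W O) :
    Circuit.eval U c ∈ Matrix.unitaryGroup (W × O) ℂ := by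
  induction c with
  | nil => exact one_mem _
  | cons s c ih => exact mul_mem ih (s.eval_mem U)

theorem Circuit.eval_append (U : Matrix.unitaryGroup O ℂ) (c c' : Circuit W O) :
    Circuit.eval U (c ++ c') = Circuit.eval U c' * Circuit.eval U c := by
  induction c with
  | nil => simp [Circuit.eval]
  | cons s c ih =>
    rw [List.cons_append, Circuit.eval, ih, Circuit.eval, Matrix.mul_assoc]

theorem Circuit.eval_singleton (U : Matrix.unitaryGroup O ℂ) (s : Step W O) :
    Circuit.eval U [s] = s.eval U := by
  simp [Circuit.eval]

theorem Step.eval_inv (U : Matrix.unitaryGroup O ℂ) (s : Step W O) :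
    s.inv.eval U = star (s.eval U) := by
  cases s <;> simp [Step.inv, Step.eval, Matrix.star_eq_conjTranspose, conjTranspose_kronecker]

theorem Circuit.eval_inv (U : Matrix.unitaryGroup O ℂ) (c : Circuit W O) :
    Circuit.eval U (Circuit.inv c) = star (Circuit.eval U c) := by
  induction c with
  | nil => simp [Circuit.inv, Circuit.eval]
  | cons s c ih =>
    have h : Circuit.inv (s :: c) = Circuit.inv c ++ [s.inv] := by simp [Circuit.inv]
    rw [h, Circuit.eval_append, ih, Circuit.eval_singleton, Step.eval_inv, Circuit.eval, star_mul]

theorem Circuit.queries_append (c c' : Circuit W O) :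
    Circuit.queries (c ++ c') = Circuit.queries c + Circuit.queries c' := by
  simp [Circuit.queries]

theorem Circuit.queries_inv (c : Circuit W O) :
    Circuit.queries (Circuit.inv c) = Circuit.queries c := by
  have h : Step.cost ∘ Step.inv = (Step.cost : Step W O → ℕ) := by
    funext s
    cases s <;> rfl
  simp [Circuit.queries, Circuit.inv, h]

theorem Circuit.queries_flatMap_range (D : ℕ → Circuit W O) (q : ℕ)
    (h : ∀ i, Circuit.queries (D i) = q) (m : ℕ) :
    Circuit.queries ((List.range m).flatMap D) = m * q := by
  induction m with
  | zero => simp [Circuit.queries]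
  | succ m ih =>
    rw [List.range_succ, List.flatMap_append, Circuit.queries_append, ih]
    simp [h, add_mul]

/-- The squared norm of a unitary's image. -/
theorem sum_norm_sq_mulVec {ι : Type} [Fintype ι] [DecidableEq ι] {V : Matrix ι ι ℂ}
    (hV : V ∈ Matrix.unitaryGroup ι ℂ) (v : ι → ℂ) :
    ∑ x, ‖(V *ᵥ v) x‖ ^ 2 = ∑ x, ‖v x‖ ^ 2 := by
  have key : ∀ u : ι → ℂ, ((∑ x, ‖u x‖ ^ 2 : ℝ) : ℂ) = star u ⬝ᵥ u := by
    intro u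
    rw [dotProduct]
    push_cast
    refine Finset.sum_congr rfl fun x _ => ?_
    rw [Pi.star_apply, RCLike.star_def, Complex.conj_mul']
  have : ((∑ x, ‖(V *ᵥ v) x‖ ^ 2 : ℝ) : ℂ) = ((∑ x, ‖v x‖ ^ 2 : ℝ) : ℂ) := by
    rw [key, key, star_mulVec, dotProduct_mulVec, vecMul_vecMul, ← Matrix.star_eq_conjTranspose,
      Matrix.mem_unitaryGroup_iff'.1 hV, vecMul_one]
  exact_mod_cast this

theorem sum_norm_sq_single {ι : Type} [Fintype ι] [DecidableEq ι] (i : ι) :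
    ∑ x, ‖(Pi.single i 1 : ι → ℂ) x‖ ^ 2 = 1 := by
  rw [Finset.sum_eq_single i] <;> simp +contextual

end Circuits

/-! ### Circuits acting branchwise over a control register -/

section Slices

variable {R W O : Type} [Fintype R] [DecidableEq R] [Fintype W] [DecidableEq W]
  [Fintype O] [DecidableEq O]

/-- The component of a state in which the register `R` is in the basis state `r`. -/
def slice (r : R) (ψ : (R × W) × O → ℂ) : W × O → ℂ := fun x => ψ ((r, x.1), x.2)

omit [DecidableEq O] in
theorem one_kronecker_mulVec (U : Matrix O O ℂ) (ψ : W × O → ℂ) (x : W × O) :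
    (((1 : Matrix W W ℂ) ⊗ₖ U) *ᵥ ψ) x = (U *ᵥ fun o => ψ (x.1, o)) x.2 := by
  simp only [mulVec, dotProduct, Fintype.sum_prod_type, kroneckerMap_apply, one_apply, ite_mul,
    one_mul, zero_mul]
  rw [Finset.sum_eq_single x.1] <;> simp +contextual [eq_comm]

omit [DecidableEq O] in
theorem slice_one_kronecker (U : Matrix O O ℂ) (r : R) (ψ : (R × W) × O → ℂ) :
    slice r (((1 : Matrix (R × W) (R × W) ℂ) ⊗ₖ U) *ᵥ ψ)
      = ((1 : Matrix W W ℂ) ⊗ₖ U) *ᵥ slice r ψ := by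
  funext x
  rw [slice, one_kronecker_mulVec, one_kronecker_mulVec]
  rfl

theorem slice_extendGate (V : Matrix.unitaryGroup (W × O) ℂ) (r : R) (ψ : (R × W) × O → ℂ) :
    slice r ((extendGate R V).1 *ᵥ ψ) = V.1 *ᵥ slice r ψ := by
  funext x
  have h : (extendGate R V).1 *ᵥ ψ
      = (((1 : Matrix R R ℂ) ⊗ₖ V.1) *ᵥ (ψ ∘ (Equiv.prodAssoc R W O).symm))
        ∘ Equiv.prodAssoc R W O := by
    simp only [extendGate]
    rw [submatrix_mulVec_equiv]
  rw [slice, h, Function.comp_apply, one_kronecker_mulVec]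
  rfl

theorem slice_step_extend (U : Matrix.unitaryGroup O ℂ) (s : Step W O) (r : R)
    (ψ : (R × W) × O → ℂ) :
    slice r ((s.extend R).eval U *ᵥ ψ) = s.eval U *ᵥ slice r ψ := by
  cases s with
  | gate V => exact slice_extendGate V r ψ
  | query => exact slice_one_kronecker _ r ψ
  | queryInv => exact slice_one_kronecker _ r ψ

theorem slice_extend (U : Matrix.unitaryGroup O ℂ) (c : Circuit W O) (r : R)
    (ψ : (R × W) × O → ℂ) :
    slice r (Circuit.eval U (Circuit.extend R c) *ᵥ ψ) = Circuit.eval U c *ᵥ slice r ψ := by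
  induction c generalizing ψ with
  | nil => simp [Circuit.extend, Circuit.eval]
  | cons s c ih =>
    have h : Circuit.extend R (s :: c) = s.extend R :: Circuit.extend R c := rfl
    rw [h, Circuit.eval, Circuit.eval, ← mulVec_mulVec, ih, slice_step_extend, mulVec_mulVec]

theorem Circuit.queries_extend (c : Circuit W O) :
    Circuit.queries (Circuit.extend R c) = Circuit.queries c := by
  have h : Step.cost ∘ Step.extend R = (Step.cost : Step W O → ℕ) := by
    funext s
    cases s <;> rfl
  simp [Circuit.queries, Circuit.extend, h]

theorem slice_onControl (V : Matrix.unitaryGroup R ℂ) (r : R) (ψ : (R × W) × O → ℂ) :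
    slice r ((onControl V).1 *ᵥ ψ) = ∑ r', V.1 r r' • slice r' ψ := by
  funext x
  simp only [slice, onControl, mulVec, dotProduct, Fintype.sum_prod_type, kroneckerMap_apply,
    one_apply, Finset.sum_apply, Pi.smul_apply, smul_eq_mul]
  refine Finset.sum_congr rfl fun r' _ => ?_
  rw [Finset.sum_eq_single x.1]
  · rw [Finset.sum_eq_single x.2] <;> simp +contextual [eq_comm]
  · intro w _ hw
    simp [hw.symm]
  · simp

theorem signGate_mulVec {ι : Type} [Fintype ι] [DecidableEq ι] (s : ι → Prop) [DecidablePred s]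
    (ψ : ι → ℂ) (x : ι) : ((signGate s).1 *ᵥ ψ) x = (if s x then -1 else 1) * ψ x := by
  simp [signGate, mulVec_diagonal]

/-- Conjugating one of two reflections by a circuit, with both reflections controlled by `ctl` on
the register `R`. -/
def controlledReflections (ctl : R → Prop) [DecidablePred ctl] (P Q : W × O → Prop)
    [DecidablePred P] [DecidablePred Q] (c : Circuit W O) : Circuit (R × W) O :=
  [Step.gate (signGate fun x => ctl x.1.1 ∧ P (x.1.2, x.2))]
    ++ Circuit.extend R (Circuit.inv c)
    ++ [Step.gate (signGate fun x => ctl x.1.1 ∧ Q (x.1.2, x.2))]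
    ++ Circuit.extend R c

theorem slice_signGate (ctl : R → Prop) [DecidablePred ctl] (P : W × O → Prop) [DecidablePred P]
    (r : R) (ψ : (R × W) × O → ℂ) :
    slice r ((signGate fun x : (R × W) × O => ctl x.1.1 ∧ P (x.1.2, x.2)).1 *ᵥ ψ)
      = if ctl r then (signGate P).1 *ᵥ slice r ψ else slice r ψ := by
  funext x
  rw [slice, signGate_mulVec]
  by_cases h : ctl r
  · simp only [h, true_and, if_true]
    rw [signGate_mulVec]
    rfl
  · simp [h, slice]

/-- In a branch where the control is off, the circuit cancels its own inverse. Controlling the two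
oracle-independent reflections therefore controls the whole product, and no controlled query is
needed. -/
theorem slice_controlledReflections (U : Matrix.unitaryGroup O ℂ) (ctl : R → Prop)
    [DecidablePred ctl] (P Q : W × O → Prop) [DecidablePred P] [DecidablePred Q] (c : Circuit W O)
    (r : R) (ψ : (R × W) × O → ℂ) :
    slice r (Circuit.eval U (controlledReflections ctl P Q c) *ᵥ ψ)
      = if ctl r then (Circuit.eval U c * (signGate Q).1 * star (Circuit.eval U c)
          * (signGate P).1) *ᵥ slice r ψ else slice r ψ := by
  rw [controlledReflections]
  simp only [Circuit.eval_append, Circuit.eval_singleton, Step.eval]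
  rw [← mulVec_mulVec, ← mulVec_mulVec, ← mulVec_mulVec, slice_extend, slice_signGate,
    slice_extend, slice_signGate, Circuit.eval_inv]
  have h := Matrix.mem_unitaryGroup_iff.1 (Circuit.eval_mem U c)
  split_ifs
  · simp only [mulVec_mulVec, Matrix.mul_assoc]
  · rw [mulVec_mulVec, h, one_mulVec]

theorem queries_controlledReflections (ctl : R → Prop)
    [DecidablePred ctl] (P Q : W × O → Prop) [DecidablePred P] [DecidablePred Q]
    (c : Circuit W O) :
    Circuit.queries (controlledReflections ctl P Q c) = 2 * Circuit.queries c := by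
  rw [controlledReflections]
  simp only [Circuit.queries_append, Circuit.queries_extend, Circuit.queries_inv]
  simp [Circuit.queries, Step.cost]
  ring

/-- Applying an operator in the rounds `i < cnt r` produces its powers. -/
theorem slice_flatMap_range (U : Matrix.unitaryGroup O ℂ) (D : ℕ → Circuit (R × W) O)
    (cnt : R → ℕ) (G : Matrix (W × O) (W × O) ℂ)
    (hD : ∀ i r ψ, slice r (Circuit.eval U (D i) *ᵥ ψ)
      = if i < cnt r then G *ᵥ slice r ψ else slice r ψ)
    (m : ℕ) (r : R) (ψ : (R × W) × O → ℂ) :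
    slice r (Circuit.eval U ((List.range m).flatMap D) *ᵥ ψ)
      = (G ^ min m (cnt r)) *ᵥ slice r ψ := by
  induction m with
  | zero => simp [Circuit.eval]
  | succ m ih =>
    rw [List.range_succ, List.flatMap_append, Circuit.eval_append, ← mulVec_mulVec]
    simp only [List.flatMap_cons, List.flatMap_nil, List.append_nil]
    rw [hD, ih]
    split_ifs with h
    · rw [min_eq_left h.le, min_eq_left (Nat.succ_le_of_lt h), pow_succ', mulVec_mulVec]
    · rw [min_eq_right (not_lt.1 h), min_eq_right ((not_lt.1 h).trans (Nat.le_succ m))]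

theorem outcomeProb_eq_sum_slice [Zero R] [Zero W] [Zero O] (c : Circuit (R × W) O)
    (U : Matrix.unitaryGroup O ℂ) (r : R) :
    outcomeProb c U r = ∑ x, ‖slice r (Circuit.eval U c *ᵥ Pi.single 0 1) x‖ ^ 2 := by
  simp [outcomeProb, slice, Fintype.sum_prod_type]

theorem outcomeProb_nonneg [Zero R] [Zero W] [Zero O] (c : Circuit (R × W) O)
    (U : Matrix.unitaryGroup O ℂ) (r : R) : 0 ≤ outcomeProb c U r :=
  Finset.sum_nonneg fun _ _ => Finset.sum_nonneg fun _ _ => by positivity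

theorem sum_outcomeProb [Zero R] [Zero W] [Zero O] (c : Circuit (R × W) O)
    (U : Matrix.unitaryGroup O ℂ) : ∑ r, outcomeProb c U r = 1 := by
  have h := sum_norm_sq_mulVec (Circuit.eval_mem U c) (Pi.single 0 1)
  rw [sum_norm_sq_single] at h
  rw [← h]
  simp [outcomeProb, Fintype.sum_prod_type]

omit [Fintype R] [Fintype W] [Fintype O] in
theorem slice_single_zero [Zero R] [Zero W] [Zero O] (r : R) :
    slice r (Pi.single 0 1 : (R × W) × O → ℂ) = if r = 0 then Pi.single 0 1 else 0 := by
  funext x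
  obtain ⟨w, o⟩ := x
  by_cases h : r = 0 <;> simp [slice, Pi.single_apply, Prod.ext_iff, h]

end Slices

/-! ### The Grover operator and the outcome distribution of amplitude estimation -/

section Grover

variable {W O : Type} [Fintype W] [DecidableEq W] [Fintype O] [DecidableEq O] [Zero W] [Zero O]

/-- The Grover operator of a circuit. -/
noncomputable def grover (U : Matrix.unitaryGroup O ℂ) (c : Circuit (Fin 2 × W) O) :
    Matrix ((Fin 2 × W) × O) ((Fin 2 × W) × O) ℂ :=
  Circuit.eval U c * (signGate fun x : (Fin 2 × W) × O => ¬ (x.1 = 0 ∧ x.2 = 0)).1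
    * star (Circuit.eval U c) * (signGate fun x : (Fin 2 × W) × O => x.1.1 = 1).1

/-- The sign gate is `2|0⟩⟨0| - I`, and conjugation by the unitary `C` replaces `|0⟩` by `C|0⟩`. -/
theorem reflection_about_mulVec (C : Matrix (W × O) (W × O) ℂ)
    (hC : C ∈ Matrix.unitaryGroup (W × O) ℂ) (u : W × O → ℂ) :
    (C * (signGate fun x : W × O => ¬ (x.1 = 0 ∧ x.2 = 0)).1 * star C) *ᵥ u
      = (2 * (star (C *ᵥ Pi.single 0 1) ⬝ᵥ u)) • (C *ᵥ Pi.single 0 1) - u := by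
  have h : ∀ v : W × O → ℂ, (signGate fun x : W × O => ¬ (x.1 = 0 ∧ x.2 = 0)).1 *ᵥ v
      = (2 * v 0) • Pi.single 0 1 - v := by
    intro v
    funext x
    rw [signGate_mulVec]
    by_cases hx : x = 0
    · subst hx
      simp
      ring
    · have : ¬ (x.1 = 0 ∧ x.2 = 0) := fun h => hx (Prod.ext h.1 h.2)
      simp [this, hx]
  have h0 : (star C *ᵥ u) 0 = star (C *ᵥ Pi.single 0 1) ⬝ᵥ u := by
    rw [star_mulVec, ← dotProduct_mulVec, Pi.star_single, star_one, single_one_dotProduct,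
      ← Matrix.star_eq_conjTranspose]
  rw [← mulVec_mulVec, ← mulVec_mulVec, h, mulVec_sub, mulVec_smul, h0, mulVec_mulVec,
    Matrix.mem_unitaryGroup_iff.1 hC, one_mulVec]

theorem flag_weights (U : Matrix.unitaryGroup O ℂ) (c : Circuit (Fin 2 × W) O) (θ : ℝ)
    (hθ : outcomeProb c U 1 = Real.sin θ ^ 2) :
    (∑ x : (Fin 2 × W) × O,
      (if x.1.1 = 1 then ‖(Circuit.eval U c *ᵥ Pi.single 0 1) x‖ ^ 2 else 0) = Real.sin θ ^ 2) ∧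
    ∑ x : (Fin 2 × W) × O,
      (if x.1.1 = 1 then 0 else ‖(Circuit.eval U c *ᵥ Pi.single 0 1) x‖ ^ 2)
        = Real.cos θ ^ 2 := by
  have h1 : ∑ x : (Fin 2 × W) × O,
      (if x.1.1 = 1 then ‖(Circuit.eval U c *ᵥ Pi.single 0 1) x‖ ^ 2 else 0)
        = Real.sin θ ^ 2 := by
    rw [← hθ, outcomeProb_eq_sum_slice]
    simp [Fintype.sum_prod_type, Fin.sum_univ_two, slice]
  refine ⟨h1, ?_⟩
  have ht : ∑ x, ‖(Circuit.eval U c *ᵥ Pi.single 0 1) x‖ ^ 2 = 1 := by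
    rw [sum_norm_sq_mulVec (Circuit.eval_mem U c), sum_norm_sq_single]
  rw [← Real.sin_sq_add_cos_sq θ, ← h1] at ht
  refine add_left_cancel (Eq.trans ?_ ht)
  rw [← Finset.sum_add_distrib]
  refine Finset.sum_congr rfl fun x _ => ?_
  split_ifs <;> simp

/-- The Grover operator preserves the span of the two flag components of `𝒜|0⟩` and rotates by `2θ`
there. Products with `cos θ` and `sin θ` in place of quotients keep the claim valid when one
component vanishes. -/
theorem grover_pow_mulVec (U : Matrix.unitaryGroup O ℂ) (c : Circuit (Fin 2 × W) O) (θ : ℝ)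
    (hθ : outcomeProb c U 1 = Real.sin θ ^ 2) (j : ℕ) :
    ∃ u v : ℝ, u * Real.cos θ = Real.cos ((2 * j + 1) * θ) ∧
      v * Real.sin θ = Real.sin ((2 * j + 1) * θ) ∧
      grover U c ^ j *ᵥ (Circuit.eval U c *ᵥ Pi.single 0 1)
        = fun x => (if x.1.1 = 1 then (v : ℂ) else u)
            * (Circuit.eval U c *ᵥ Pi.single 0 1) x := by
  set ψ := Circuit.eval U c *ᵥ Pi.single 0 1 with hψ
  obtain ⟨h1, h0⟩ := flag_weights U c θ hθ
  rw [← hψ] at h1 h0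
  induction j with
  | zero => exact ⟨1, 1, by simp, by simp, by simp⟩
  | succ j ih =>
    obtain ⟨u, v, hu, hv, huv⟩ := ih
    set K : ℝ := 2 * (u * Real.cos θ ^ 2 - v * Real.sin θ ^ 2) with hK
    refine ⟨K - u, K + v, ?_, ?_, ?_⟩
    · have : ((2 * ((j + 1 : ℕ) : ℝ) + 1) * θ) = (2 * j + 1) * θ + 2 * θ := by push_cast; ring
      rw [this, Real.cos_add, ← hu, ← hv, hK, Real.cos_two_mul, Real.sin_two_mul]
      ring
    · have : ((2 * ((j + 1 : ℕ) : ℝ) + 1) * θ) = (2 * j + 1) * θ + 2 * θ := by push_cast; ring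
      rw [this, Real.sin_add, ← hu, ← hv, hK, Real.cos_two_mul, Real.sin_two_mul]
      have := Real.sin_sq_add_cos_sq θ
      linear_combination (-2 * v * Real.sin θ) * this
    · rw [pow_succ', ← mulVec_mulVec, huv, grover, ← mulVec_mulVec,
        reflection_about_mulVec _ (Circuit.eval_mem U c), ← hψ]
      have hd : star ψ ⬝ᵥ ((signGate fun x : (Fin 2 × W) × O => x.1.1 = 1).1 *ᵥ
          fun x => (if x.1.1 = 1 then (v : ℂ) else u) * ψ x)
          = ((u * Real.cos θ ^ 2 - v * Real.sin θ ^ 2 : ℝ) : ℂ) := by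
        rw [← h0, ← h1, Finset.mul_sum, Finset.mul_sum, ← Finset.sum_sub_distrib, dotProduct]
        push_cast
        refine Finset.sum_congr rfl fun x _ => ?_
        rw [signGate_mulVec, Pi.star_apply, RCLike.star_def]
        have := Complex.conj_mul' (ψ x)
        split_ifs
        · push_cast
          linear_combination (-(v : ℂ)) * this
        · push_cast
          linear_combination (u : ℂ) * this
      rw [hd]
      funext x
      simp only [Pi.sub_apply, Pi.smul_apply, smul_eq_mul]
      rw [signGate_mulVec, hK]
      split_ifs <;> push_cast <;> ring

theorem controlledGrover_eq (N : ℕ) (c : Circuit (Fin 2 × W) O) (i : ℕ) :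
    controlledGrover N c i = controlledReflections (fun j : Fin N => i < (j : ℕ))
      (fun x : (Fin 2 × W) × O => x.1.1 = 1) (fun x => ¬ (x.1 = 0 ∧ x.2 = 0)) c := rfl

theorem queries_amplitudeEstimation (t : ℕ) (c : Circuit (Fin 2 × W) O) :
    Circuit.queries (amplitudeEstimation t c)
      = Circuit.queries c + (2 ^ t - 1) * (2 * Circuit.queries c) := by
  rw [amplitudeEstimation]
  simp only [Circuit.queries_append]
  rw [Circuit.queries_extend, Circuit.queries_flatMap_range _ (2 * Circuit.queries c)]
  · simp [Circuit.queries, Step.cost]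
  · intro i
    rw [controlledGrover_eq, queries_controlledReflections]

theorem slice_amplitudeEstimation (U : Matrix.unitaryGroup O ℂ) (t : ℕ)
    (c : Circuit (Fin 2 × W) O) (y : Reg t) :
    slice y (Circuit.eval U (amplitudeEstimation t c) *ᵥ Pi.single 0 1)
      = ∑ j : Reg t, (star (fourierMatrix (2 ^ t) j y) * fourierMatrix (2 ^ t) j 0) •
          (grover U c ^ (j : ℕ) *ᵥ (Circuit.eval U c *ᵥ Pi.single 0 1)) := by
  rw [amplitudeEstimation]
  simp only [Circuit.eval_append, Circuit.eval_singleton, Step.eval]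
  rw [← mulVec_mulVec, ← mulVec_mulVec, ← mulVec_mulVec, slice_onControl]
  refine Finset.sum_congr rfl fun j _ => ?_
  rw [slice_flatMap_range U _ (fun j : Reg t => (j : ℕ)) (grover U c)]
  · rw [slice_extend, slice_onControl, Finset.sum_eq_single 0]
    -- Control values are at most `2 ^ t - 1`, so that many rounds realize every power.
    · have hj : min (2 ^ t - 1) (j : ℕ) = j := min_eq_right (by have := j.2; omega)
      rw [hj, slice_single_zero, if_pos rfl, mulVec_smul, mulVec_smul, smul_smul]
      rfl
    · intro r _ hr
      rw [slice_single_zero, if_neg hr, smul_zero]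
    · simp
  · intro i r ψ
    rw [controlledGrover_eq, slice_controlledReflections]
    rfl

/-- Outcome probabilities of amplitude estimation, as an average of two Fejér kernels. -/
theorem outcomeProb_amplitudeEstimation (U : Matrix.unitaryGroup O ℂ) (t : ℕ)
    (c : Circuit (Fin 2 × W) O) (θ : ℝ) (hθ : outcomeProb c U 1 = Real.sin θ ^ 2) (y : Reg t) :
    outcomeProb (amplitudeEstimation t c) U y
      = (‖∑ j : Reg t, (star (fourierMatrix (2 ^ t) j y) * fourierMatrix (2 ^ t) j 0)
            * Complex.exp (((2 * (j : ℕ) + 1) * θ : ℝ) * Complex.I)‖ ^ 2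
        + ‖∑ j : Reg t, (star (fourierMatrix (2 ^ t) j y) * fourierMatrix (2 ^ t) j 0)
            * Complex.exp (-((2 * (j : ℕ) + 1) * θ : ℝ) * Complex.I)‖ ^ 2) / 2 := by
  set f : Reg t → ℂ := fun j => star (fourierMatrix (2 ^ t) j y) * fourierMatrix (2 ^ t) j 0
    with hf
  set ψ := Circuit.eval U c *ᵥ Pi.single 0 1 with hψ
  choose u v hu hv huv using fun j : ℕ => grover_pow_mulVec U c θ hθ j
  simp only [← hψ] at huv
  obtain ⟨h1, h0⟩ := flag_weights U c θ hθ
  rw [← hψ] at h1 h0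
  -- By Euler's formula the flag components carry half the sum and, up to a phase, half the
  -- difference of the phase sums at `θ` and `-θ`. The parallelogram law then removes the cross
  -- terms.
  have hA : (∑ j : Reg t, f j * u j) * (Real.cos θ : ℂ)
      = (∑ j : Reg t, f j * Complex.exp (((2 * (j : ℕ) + 1) * θ : ℝ) * Complex.I)
        + ∑ j : Reg t, f j * Complex.exp (-((2 * (j : ℕ) + 1) * θ : ℝ) * Complex.I)) / 2 := by
    rw [← Finset.sum_add_distrib, Finset.sum_mul, Finset.sum_div]
    refine Finset.sum_congr rfl fun j _ => ?_
    rw [mul_assoc, ← Complex.ofReal_mul, hu, Complex.ofReal_cos, Complex.cos]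
    ring
  have hB : (∑ j : Reg t, f j * v j) * (Real.sin θ : ℂ)
      = (∑ j : Reg t, f j * Complex.exp (-((2 * (j : ℕ) + 1) * θ : ℝ) * Complex.I)
        - ∑ j : Reg t, f j * Complex.exp (((2 * (j : ℕ) + 1) * θ : ℝ) * Complex.I))
          * (Complex.I / 2) := by
    rw [← Finset.sum_sub_distrib, Finset.sum_mul, Finset.sum_mul]
    refine Finset.sum_congr rfl fun j _ => ?_
    rw [mul_assoc, ← Complex.ofReal_mul, hv, Complex.ofReal_sin, Complex.sin]
    ring
  have hs : ∀ x, (∑ j : Reg t, f j • (grover U c ^ (j : ℕ) *ᵥ ψ)) x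
      = (if x.1.1 = 1 then ∑ j : Reg t, f j * v j else ∑ j : Reg t, f j * u j) * ψ x := by
    intro x
    rw [Finset.sum_apply]
    split_ifs with hx <;> rw [Finset.sum_mul] <;> refine Finset.sum_congr rfl fun j _ => ?_ <;>
      rw [Pi.smul_apply, huv] <;> simp [hx, mul_assoc]
  have hsum : outcomeProb (amplitudeEstimation t c) U y
      = ‖(∑ j : Reg t, f j * u j) * (Real.cos θ : ℂ)‖ ^ 2
        + ‖(∑ j : Reg t, f j * v j) * (Real.sin θ : ℂ)‖ ^ 2 := by
    rw [outcomeProb_eq_sum_slice, slice_amplitudeEstimation]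
    simp only [← hψ, norm_mul, mul_pow, Complex.norm_real, Real.norm_eq_abs, sq_abs]
    rw [← h0, ← h1, Finset.mul_sum, Finset.mul_sum, ← Finset.sum_add_distrib]
    refine Finset.sum_congr rfl fun x _ => ?_
    rw [hs]
    split_ifs <;> simp [mul_pow]
  rw [hsum, hA, hB]
  set a := ∑ j : Reg t, f j * Complex.exp (((2 * (j : ℕ) + 1) * θ : ℝ) * Complex.I)
  set b := ∑ j : Reg t, f j * Complex.exp (-((2 * (j : ℕ) + 1) * θ : ℝ) * Complex.I)
  have hpar := parallelogram_law_with_norm ℝ a b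
  have hI : ‖Complex.I / 2‖ = 1 / 2 := by simp
  rw [norm_div, norm_mul, hI, norm_sub_rev b a]
  norm_num
  nlinarith

end Grover

/-! ### Tail bounds for the Fejér kernel -/

theorem norm_exp_mul_I_sub_one (x : ℝ) :
    ‖Complex.exp ((2 * x : ℝ) * Complex.I) - 1‖ = 2 * |Real.sin x| := by
  have h : Complex.exp ((2 * x : ℝ) * Complex.I) - 1
      = Complex.exp (x * Complex.I) * (2 * Complex.I * Complex.sin x) := by
    have h2 : ((2 * x : ℝ) : ℂ) * Complex.I = x * Complex.I + x * Complex.I := by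
      push_cast; ring
    have h3 : Complex.exp (-x * Complex.I) * Complex.exp (x * Complex.I) = 1 := by
      rw [← Complex.exp_add]; simp
    rw [h2, Complex.exp_add, Complex.sin]
    linear_combination (1 : ℂ) * h3
      - (Complex.exp (x * Complex.I) * (Complex.exp (-x * Complex.I)
        - Complex.exp (x * Complex.I))) * Complex.I_sq
  rw [h, norm_mul, Complex.norm_exp_ofReal_mul_I, norm_mul, norm_mul, ← Complex.ofReal_sin,
    Complex.norm_real, Real.norm_eq_abs]
  simp

/-- The Fejér kernel bound for the phase estimation amplitudes. -/
theorem norm_phase_amplitude_le (N : ℕ) [NeZero N] (φ : ℝ) (y : Fin N)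
    (h : Real.sin (φ - Real.pi * (y : ℕ) / N) ≠ 0) :
    ‖∑ j : Fin N, (star (fourierMatrix N j y) * fourierMatrix N j 0)
        * Complex.exp (((2 * (j : ℕ) + 1) * φ : ℝ) * Complex.I)‖
      ≤ 1 / (N * |Real.sin (φ - Real.pi * (y : ℕ) / N)|) := by
  have hN : (0 : ℝ) < N := Nat.cast_pos.2 (NeZero.pos N)
  have hNc : (N : ℂ) ≠ 0 := by exact_mod_cast hN.ne'
  have hsq : (Real.sqrt N : ℂ) * (Real.sqrt N : ℂ) = N := by
    rw [← Complex.ofReal_mul, Real.mul_self_sqrt hN.le]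
    simp
  set x : ℝ := φ - Real.pi * (y : ℕ) / N with hx
  set z : ℂ := Complex.exp ((2 * x : ℝ) * Complex.I) with hz
  have hterm : ∀ j : Fin N, (star (fourierMatrix N j y) * fourierMatrix N j 0)
        * Complex.exp (((2 * (j : ℕ) + 1) * φ : ℝ) * Complex.I)
      = (Complex.exp (φ * Complex.I) / N) * z ^ (j : ℕ) := by
    intro j
    rw [fourierMatrix, fourierMatrix, star_div₀, RCLike.star_def, Complex.conj_ofReal,
      div_mul_div_comm, hsq, ← Complex.exp_conj, hz, ← Complex.exp_nat_mul, div_mul_eq_mul_div,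
      div_mul_eq_mul_div, ← Complex.exp_add, ← Complex.exp_add, ← Complex.exp_add]
    congr 2
    simp only [map_div₀, map_mul, Complex.conj_ofReal, Complex.conj_I, map_natCast, map_ofNat, hx]
    push_cast
    simp
    field_simp
    ring
  have hz1 : 0 < ‖z - 1‖ := by
    rw [hz, norm_exp_mul_I_sub_one]
    positivity
  have hz1' : z ≠ 1 := fun h => by simp [h] at hz1
  rw [Finset.sum_congr rfl fun j _ => hterm j, ← Finset.mul_sum,
    Fin.sum_univ_eq_sum_range (fun k => z ^ k) N, geom_sum_eq hz1', norm_mul, norm_div, norm_div,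
    Complex.norm_exp_ofReal_mul_I, Complex.norm_natCast]
  have hz2 : ‖z ^ N - 1‖ ≤ 2 := by
    refine (norm_sub_le _ _).trans ?_
    rw [norm_pow, hz, Complex.norm_exp_ofReal_mul_I]
    norm_num
  rw [hz, norm_exp_mul_I_sub_one, ← hz]
  have hs : 0 < |Real.sin x| := abs_pos.2 h
  calc 1 / (N : ℝ) * (‖z ^ N - 1‖ / (2 * |Real.sin x|))
      ≤ 1 / (N : ℝ) * (2 / (2 * |Real.sin x|)) := by gcongr
    _ = 1 / (N * |Real.sin x|) := by field_simp

/-- The bound `1 / u² ≤ 1 / (u - 1/2) - 1 / (u + 1/2)` telescopes. The maximum with `L` in `G` makes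
the differences nonnegative also where the summand is 0, and caps the first term by `1 / (L - 1/2) ≤
2 / L`. -/
theorem sum_inv_sq_progression_right_le (a L : ℝ) (hL : 1 ≤ L) (N : ℕ) :
    ∑ y ∈ Finset.range N, (if L < (y : ℝ) - a then 1 / ((y : ℝ) - a) ^ 2 else 0) ≤ 2 / L := by
  set G : ℕ → ℝ := fun y => 1 / (max ((y : ℝ) - a) L - 1 / 2) with hG
  have hpos : ∀ y : ℕ, 1 / 2 ≤ max ((y : ℝ) - a) L - 1 / 2 := fun y => by
    have := le_max_right ((y : ℝ) - a) L
    linarith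
  calc ∑ y ∈ Finset.range N, (if L < (y : ℝ) - a then 1 / ((y : ℝ) - a) ^ 2 else 0)
      ≤ ∑ y ∈ Finset.range N, (G y - G (y + 1)) := by
        refine Finset.sum_le_sum fun y _ => ?_
        split_ifs with h
        · simp only [hG]
          have e : max (((y + 1 : ℕ) : ℝ) - a) L = (y : ℝ) - a + 1 := by
            rw [max_eq_left]
            · push_cast; ring
            · push_cast; linarith
          rw [max_eq_left h.le, e]
          set u := (y : ℝ) - a
          rw [div_sub_div _ _ (by linarith) (by linarith), div_le_div_iff₀ (by nlinarith)
            (by nlinarith)]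
          nlinarith
        · refine sub_nonneg.2 (one_div_le_one_div_of_le (by linarith [hpos y]) ?_)
          have : max ((y : ℝ) - a) L ≤ max (((y + 1 : ℕ) : ℝ) - a) L := by
            refine max_le_max ?_ le_rfl
            push_cast
            linarith
          linarith
    _ = G 0 - G N := Finset.sum_range_sub' G N
    _ ≤ G 0 := by
        have : 0 ≤ G N := one_div_nonneg.2 (by linarith [hpos N])
        linarith
    _ ≤ 2 / L := by
        have := le_max_right (((0 : ℕ) : ℝ) - a) L
        simp only [hG]
        generalize max (((0 : ℕ) : ℝ) - a) L = m at this ⊢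
        rw [div_le_div_iff₀ (by linarith) (by linarith)]
        linarith

theorem sum_inv_sq_progression_le (a L : ℝ) (hL : 1 ≤ L) (N : ℕ) :
    ∑ y ∈ Finset.range N, (if L < |(y : ℝ) - a| then 1 / ((y : ℝ) - a) ^ 2 else 0) ≤ 4 / L := by
  have h1 := sum_inv_sq_progression_right_le a L hL N
  have h2 := sum_inv_sq_progression_right_le ((N : ℝ) - 1 - a) L hL N
  rw [← Finset.sum_range_reflect] at h2
  have h3 : ∑ y ∈ Finset.range N, (if L < |(y : ℝ) - a| then 1 / ((y : ℝ) - a) ^ 2 else 0)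
      ≤ ∑ y ∈ Finset.range N, (if L < (y : ℝ) - a then 1 / ((y : ℝ) - a) ^ 2 else 0)
        + ∑ y ∈ Finset.range N, (if L < ((N - 1 - y : ℕ) : ℝ) - (N - 1 - a)
            then 1 / (((N - 1 - y : ℕ) : ℝ) - (N - 1 - a)) ^ 2 else 0) := by
    rw [← Finset.sum_add_distrib]
    refine Finset.sum_le_sum fun y hy => ?_
    have hy' : y + 1 ≤ N := Finset.mem_range.1 hy
    have e : ((N - 1 - y : ℕ) : ℝ) - (N - 1 - a) = -(y - a) := by
      rw [Nat.sub_sub, Nat.cast_sub (by omega)]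
      push_cast
      ring
    rw [e, neg_sq]
    have hnn : (0 : ℝ) ≤ 1 / ((y : ℝ) - a) ^ 2 := by positivity
    by_cases h : L < |(y : ℝ) - a|
    · rw [if_pos h]
      rcases lt_abs.1 h with h' | h' <;> rw [if_pos h'] <;> split_ifs <;> linarith
    · rw [if_neg h]
      split_ifs <;> linarith
  calc _ ≤ _ := h3
    _ ≤ 2 / L + 2 / L := add_le_add h1 h2
    _ = 4 / L := by ring

theorem two_div_pi_mul_le_abs_sin {x : ℝ} (h : |x| ≤ Real.pi / 2) :
    2 / Real.pi * |x| ≤ |Real.sin x| := by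
  have h0 := Real.mul_le_sin (abs_nonneg x) h
  rcases abs_cases x with ⟨hx, _⟩ | ⟨hx, _⟩
  · rw [hx] at h0 ⊢
    exact h0.trans (le_abs_self _)
  · rw [hx] at h0 ⊢
    rw [Real.sin_neg] at h0
    exact h0.trans (neg_le_abs _)

/-- By `|sin x| ≥ 2|x| / π` the kernel at `y` is at most `1 / (4 v²)`, where `v` is the distance of
`y` from the peak `a = Nφ / π` or from its periodic copy `a + N`. Only distances above `L = Nη / π`
occur, so the two peaks contribute `2 / L = 2π / (Nη)`, and `2π ≤ 7`. -/
theorem sum_fejer_tail_le (φ η : ℝ) (hφ : |φ| ≤ Real.pi / 2) (hη : 0 < η) (N : ℕ)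
    (hN : Real.pi ≤ N * η) :
    ∑ y ∈ Finset.range N, (if η < |Real.sin (φ - Real.pi * y / N)| then
      (1 / (N * |Real.sin (φ - Real.pi * y / N)|)) ^ 2 else 0) ≤ 7 / (N * η) := by
  have hpi := Real.pi_pos
  have hN0 : (0 : ℝ) < N := by
    by_contra h
    have : (N : ℝ) = 0 := le_antisymm (not_lt.1 h) (Nat.cast_nonneg N)
    rw [this] at hN
    linarith
  set L : ℝ := N * η / Real.pi with hL
  have hL1 : 1 ≤ L := by rw [hL, le_div_iff₀ hpi]; linarith
  set a : ℝ := N * φ / Real.pi with ha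
  have h1 := sum_inv_sq_progression_le a L hL1 N
  have h2 := sum_inv_sq_progression_le (a + N) L hL1 N
  have key : ∀ x : ℝ, |x| ≤ Real.pi / 2 → η < |Real.sin x| → ∀ v : ℝ, |v| = N * |x| / Real.pi →
      L < |v| ∧ (1 / (N * |Real.sin x|)) ^ 2 ≤ 1 / 4 * (1 / v ^ 2) := by
    intro x hx hs v hv
    have hxs : η < |x| := hs.trans_le Real.abs_sin_le_abs
    refine ⟨by rw [hv, hL]; gcongr, ?_⟩
    rw [← sq_abs v, hv, div_pow, one_pow, mul_pow, div_pow, one_div_div]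
    have hx0 : 0 < |x| := hη.trans hxs
    have hs2 : (2 / Real.pi * |x|) ^ 2 ≤ |Real.sin x| ^ 2 := by
      gcongr
      exact two_div_pi_mul_le_abs_sin hx
    have : (2 / Real.pi * |x|) ^ 2 = 4 * |x| ^ 2 / Real.pi ^ 2 := by ring
    rw [this, div_le_iff₀ (by positivity)] at hs2
    have hs0 : 0 < |Real.sin x| := hη.trans hs
    rw [div_mul_div_comm, one_mul, div_le_div_iff₀ (by positivity) (by positivity)]
    nlinarith [mul_le_mul_of_nonneg_left hs2 (sq_nonneg (N : ℝ))]
  have hterm : ∀ y ∈ Finset.range N, (if η < |Real.sin (φ - Real.pi * y / N)| then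
      (1 / (N * |Real.sin (φ - Real.pi * y / N)|)) ^ 2 else 0)
      ≤ 1 / 4 * (if L < |(y : ℝ) - a| then 1 / ((y : ℝ) - a) ^ 2 else 0)
        + 1 / 4 * (if L < |(y : ℝ) - (a + N)| then 1 / ((y : ℝ) - (a + N)) ^ 2 else 0) := by
    intro y hy
    have hy' : (y : ℝ) ≤ N := by exact_mod_cast (Finset.mem_range.1 hy).le
    have hnn1 : (0 : ℝ) ≤ 1 / ((y : ℝ) - a) ^ 2 := by positivity
    have hnn2 : (0 : ℝ) ≤ 1 / ((y : ℝ) - (a + N)) ^ 2 := by positivity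
    split_ifs with h h3 h4 h4 <;> try positivity
    all_goals
      have hz0 : 0 ≤ Real.pi * y / N := by positivity
      have hz1 : Real.pi * y / N ≤ Real.pi := by
        rw [div_le_iff₀ hN0]
        gcongr
      have hφ' := abs_le.1 hφ
      -- The angle lies in `[-3π/2, π/2]`. Below `-π/2`, adding `π` keeps `|sin|` and moves the peak
      -- from `a` to `a + N`.
      rcases le_total (-(Real.pi / 2)) (φ - Real.pi * y / N) with hc | hc
      · obtain ⟨hk1, hk2⟩ := key (φ - Real.pi * y / N) (abs_le.2 ⟨hc, by linarith⟩) h (y - a) (by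
          rw [ha, ← abs_neg, ← abs_of_pos hN0, ← abs_mul, abs_of_pos hN0,
            ← abs_of_pos hpi, ← abs_div, abs_of_pos hpi]
          congr 1
          field_simp
          ring)
        first
        | exact absurd hk1 (by assumption)
        | linarith
      · have hs : |Real.sin (φ - Real.pi * y / N + Real.pi)| = |Real.sin (φ - Real.pi * y / N)| := by
          rw [Real.sin_add_pi, abs_neg]
        obtain ⟨hk1, hk2⟩ := key (φ - Real.pi * y / N + Real.pi)
          (abs_le.2 ⟨by linarith, by linarith⟩) (by rwa [hs]) (y - (a + N)) (by
          rw [ha, ← abs_neg, ← abs_of_pos hN0, ← abs_mul, abs_of_pos hN0,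
            ← abs_of_pos hpi, ← abs_div, abs_of_pos hpi]
          congr 1
          field_simp
          ring)
        rw [hs] at hk2
        first
        | exact absurd hk1 (by assumption)
        | linarith
  have hsum := Finset.sum_le_sum hterm
  rw [Finset.sum_add_distrib, ← Finset.mul_sum, ← Finset.mul_sum] at hsum
  have hfin : 1 / 4 * (4 / L) + 1 / 4 * (4 / L) ≤ 7 / (N * η) := by
    rw [hL]
    have : 1 / 4 * (4 / (N * η / Real.pi)) + 1 / 4 * (4 / (N * η / Real.pi))
        = 2 * Real.pi / (N * η) := by
      field_simp
      ring
    rw [this]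
    gcongr
    linarith [Real.pi_lt_d2]
  linarith

/-! ### Concentration of amplitude estimation -/

section

variable {W O : Type} [Fintype W] [DecidableEq W] [Fintype O] [DecidableEq O] [Zero W] [Zero O]

/-- The difference factors as `-sin (φ - α) sin (φ + α)`. Thus an outcome that misses the
probability by more than `η` lies in the tail of the kernel, at either sign of the angle. -/
theorem abs_sin_sq_sub_sin_sq_le (α φ : ℝ) :
    |Real.sin α ^ 2 - Real.sin φ ^ 2| ≤ |Real.sin (φ - α)| := by
  have h : Real.sin α ^ 2 - Real.sin φ ^ 2 = -(Real.sin (φ - α) * Real.sin (φ + α)) := by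
    rw [Real.sin_sub, Real.sin_add]
    have h1 := Real.sin_sq_add_cos_sq α
    have h2 := Real.sin_sq_add_cos_sq φ
    linear_combination (Real.sin φ ^ 2) * h1 - (Real.sin α ^ 2) * h2
  rw [h, abs_neg, abs_mul]
  exact mul_le_of_le_one_right (abs_nonneg _) (Real.abs_sin_le_one _)

theorem sum_norm_phase_amplitude_sq_le (t : ℕ) (p φ η : ℝ) (hp : p = Real.sin φ ^ 2)
    (hφ : |φ| ≤ Real.pi / 2) (hη : 0 < η) (hN : Real.pi ≤ 2 ^ t * η) :
    ∑ y : Reg t, (if |Real.sin (Real.pi * (y : ℕ) / 2 ^ t) ^ 2 - p| ≤ η then 0 else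
      ‖∑ j : Reg t, (star (fourierMatrix (2 ^ t) j y) * fourierMatrix (2 ^ t) j 0)
        * Complex.exp (((2 * (j : ℕ) + 1) * φ : ℝ) * Complex.I)‖ ^ 2) ≤ 7 / (2 ^ t * η) := by
  have h := sum_fejer_tail_le φ η hφ hη (2 ^ t) (by exact_mod_cast hN)
  push_cast at h
  refine le_trans ?_ h
  rw [← Fin.sum_univ_eq_sum_range (fun y => (if η < |Real.sin (φ - Real.pi * y / 2 ^ t)| then
    (1 / (2 ^ t * |Real.sin (φ - Real.pi * y / 2 ^ t)|)) ^ 2 else 0)) (2 ^ t)]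
  refine Finset.sum_le_sum fun y _ => ?_
  by_cases hy : |Real.sin (Real.pi * (y : ℕ) / 2 ^ t) ^ 2 - p| ≤ η
  · rw [if_pos hy]
    split_ifs <;> positivity
  · have hy' := (not_le.1 hy).trans_le
      ((congrArg _ (by rw [hp])).trans_le (abs_sin_sq_sub_sin_sq_le _ φ))
    rw [if_neg hy, if_pos hy']
    have hb := norm_phase_amplitude_le (2 ^ t) φ y (by
      push_cast
      exact abs_pos.1 (hη.trans hy'))
    push_cast at hb ⊢
    gcongr

/-- Amplitude estimation with `2 ^ t` points misses the probability of the flag by more than `η`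
with probability at most `7 / (2 ^ t * η)`. -/
theorem amplitudeEstimation_concentration (U : Matrix.unitaryGroup O ℂ) (t : ℕ)
    (c : Circuit (Fin 2 × W) O) (η : ℝ) (hη : 0 < η) (hN : Real.pi ≤ 2 ^ t * η) :
    1 - 7 / (2 ^ t * η) ≤ ∑ y : Reg t,
      (if |Real.sin (Real.pi * (y : ℕ) / 2 ^ t) ^ 2 - outcomeProb c U 1| ≤ η then
        outcomeProb (amplitudeEstimation t c) U y else 0) := by
  have hp0 := outcomeProb_nonneg c U 1
  have hp1 : outcomeProb c U 1 ≤ 1 := by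
    rw [← sum_outcomeProb c U]
    exact Finset.single_le_sum (fun r _ => outcomeProb_nonneg c U r) (Finset.mem_univ 1)
  set p := outcomeProb c U 1 with hp
  set θ := Real.arcsin (Real.sqrt p) with hθ
  have hpθ : p = Real.sin θ ^ 2 := by
    rw [hθ, Real.sin_arcsin (by linarith [Real.sqrt_nonneg p]) (Real.sqrt_le_one.2 hp1),
      Real.sq_sqrt hp0]
  have hθ2 : |θ| ≤ Real.pi / 2 :=
    abs_le.2 ⟨Real.neg_pi_div_two_le_arcsin _, Real.arcsin_le_pi_div_two _⟩
  have h1 := sum_norm_phase_amplitude_sq_le t p θ η hpθ hθ2 hη hN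
  have h2 := sum_norm_phase_amplitude_sq_le t p (-θ) η (by rw [Real.sin_neg, neg_sq, hpθ])
    (by rwa [abs_neg]) hη hN
  have htot := sum_outcomeProb (amplitudeEstimation t c) U
  have hsplit : ∑ y : Reg t,
      (if |Real.sin (Real.pi * (y : ℕ) / 2 ^ t) ^ 2 - p| ≤ η then
        outcomeProb (amplitudeEstimation t c) U y else 0)
      + ∑ y : Reg t, (if |Real.sin (Real.pi * (y : ℕ) / 2 ^ t) ^ 2 - p| ≤ η then 0 else
        outcomeProb (amplitudeEstimation t c) U y) = 1 := by
    rw [← htot, ← Finset.sum_add_distrib]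
    refine Finset.sum_congr rfl fun y _ => ?_
    split_ifs <;> simp
  have hbad : ∑ y : Reg t, (if |Real.sin (Real.pi * (y : ℕ) / 2 ^ t) ^ 2 - p| ≤ η then 0 else
        outcomeProb (amplitudeEstimation t c) U y) ≤ 7 / (2 ^ t * η) := by
    -- The outcome probability is the mean of the kernels at `θ` and `-θ`, so the two tail bounds
    -- are averaged.
    have := add_le_add h1 h2
    rw [← Finset.sum_add_distrib] at this
    refine le_trans (le_of_eq ?_) (b := (7 / (2 ^ t * η) + 7 / (2 ^ t * η)) / 2) (by linarith)
      |>.trans' ((div_le_div_of_nonneg_right this zero_le_two).trans' (le_of_eq ?_))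
    · ring
    · rw [Finset.sum_div]
      refine Finset.sum_congr rfl fun y _ => ?_
      rw [outcomeProb_amplitudeEstimation U t c θ (hp ▸ hpθ) y]
      split_ifs
      · simp
      · simp only [mul_neg, Complex.ofReal_neg]
  linarith

end

/-! ### Independent repetitions and Chebyshev's inequality -/

section IID

variable {R : Type} [Fintype R]

theorem iidProb_one (p : R → ℝ) (E : R → Prop) [DecidablePred E] :
    iidProb 1 p (fun x => E (x 0)) = ∑ r, if E r then p r else 0 := by
  rw [iidProb, ← (Equiv.funUnique (Fin 1) R).symm.sum_comp]
  refine Finset.sum_congr rfl fun r _ => ?_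
  simp

theorem sum_fin_succ_fun (M : ℕ) (F : (Fin (M + 1) → R) → ℝ) :
    ∑ x, F x = ∑ r, ∑ x : Fin M → R, F (Fin.cons r x) := by
  rw [← (Fin.consEquiv fun _ => R).sum_comp, Fintype.sum_prod_type]
  rfl

/-- Splitting off the first sample expands the square. The cross term vanishes because `f` is
centred, so variances add. The three moments are proved together because the induction for the last
one uses the other two. -/
theorem iid_moments (p f : R → ℝ) (hp : ∑ r, p r = 1) (hf : ∑ r, p r * f r = 0) (M : ℕ) :
    (∑ x : Fin M → R, ∏ i, p (x i) = 1) ∧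
    (∑ x : Fin M → R, (∏ i, p (x i)) * ∑ i, f (x i) = 0) ∧
    ∑ x : Fin M → R, (∏ i, p (x i)) * (∑ i, f (x i)) ^ 2 = M * ∑ r, p r * f r ^ 2 := by
  induction M with
  | zero => simp
  | succ M ih =>
    obtain ⟨h0, h1, h2⟩ := ih
    refine ⟨?_, ?_, ?_⟩
    · rw [sum_fin_succ_fun]
      simp only [Fin.prod_univ_succ, Fin.cons_zero, Fin.cons_succ, ← Finset.mul_sum, h0, mul_one,
        hp]
    · rw [sum_fin_succ_fun]
      simp only [Fin.prod_univ_succ, Fin.sum_univ_succ, Fin.cons_zero, Fin.cons_succ, mul_add,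
        Finset.sum_add_distrib, mul_assoc, ← Finset.mul_sum, h1, mul_zero, add_zero]
      simp only [mul_comm _ (f _), ← Finset.mul_sum, h0, mul_one]
      simpa only [mul_comm] using hf
    · rw [sum_fin_succ_fun]
      have e : ∀ r, ∑ x : Fin M → R, (∏ i, p ((Fin.cons r x : Fin (M + 1) → R) i))
          * (∑ i, f ((Fin.cons r x : Fin (M + 1) → R) i)) ^ 2
          = p r * f r ^ 2 + p r * (M * ∑ r, p r * f r ^ 2) := by
        intro r
        have : ∀ x : Fin M → R, (∏ i, p ((Fin.cons r x : Fin (M + 1) → R) i))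
            * (∑ i, f ((Fin.cons r x : Fin (M + 1) → R) i)) ^ 2
            = p r * f r ^ 2 * (∏ i, p (x i)) + 2 * p r * f r * ((∏ i, p (x i)) * ∑ i, f (x i))
              + p r * ((∏ i, p (x i)) * (∑ i, f (x i)) ^ 2) := by
          intro x
          simp only [Fin.prod_univ_succ, Fin.sum_univ_succ, Fin.cons_zero, Fin.cons_succ]
          ring
        rw [Finset.sum_congr rfl fun x _ => this x, Finset.sum_add_distrib, Finset.sum_add_distrib,
          ← Finset.mul_sum, ← Finset.mul_sum, ← Finset.mul_sum, h0, h1, h2]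
        ring
      rw [Finset.sum_congr rfl fun r _ => e r, Finset.sum_add_distrib, ← Finset.sum_mul, hp]
      push_cast
      ring

/-- Chebyshev's inequality for the relative frequency of an outcome. -/
theorem iidProb_frequency (p : Fin 2 → ℝ) (hp0 : ∀ r, 0 ≤ p r) (hp : ∑ r, p r = 1) (M : ℕ)
    (hM : 0 < M) (η : ℝ) (hη : 0 < η) :
    1 - 1 / (4 * M * η ^ 2) ≤
      iidProb M p (fun x => |(∑ i, ((x i : ℕ) : ℝ)) / M - p 1| ≤ η) := by
  classical
  have hp2 : p 0 + p 1 = 1 := by simpa [Fin.sum_univ_two] using hp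
  have hf : ∑ r, p r * (((r : ℕ) : ℝ) - p 1) = 0 := by
    simp only [Fin.sum_univ_two, Fin.val_zero, Fin.val_one, Nat.cast_zero, Nat.cast_one]
    linear_combination (-(p 1)) * hp2
  have hv : ∑ r, p r * (((r : ℕ) : ℝ) - p 1) ^ 2 ≤ 1 / 4 := by
    have h0 : p 0 = 1 - p 1 := by linarith
    simp only [Fin.sum_univ_two, Fin.val_zero, Fin.val_one, Nat.cast_zero, Nat.cast_one]
    rw [h0]
    nlinarith [sq_nonneg (2 * p 1 - 1)]
  obtain ⟨h0, -, h2⟩ := iid_moments p (fun r => ((r : ℕ) : ℝ) - p 1) hp hf M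
  have hM' : (0 : ℝ) < M := Nat.cast_pos.2 hM
  -- Markov's inequality pointwise: off the event the subtracted term is at least the probability of
  -- `x`, so the left side is not positive.
  have hterm : ∀ x : Fin M → Fin 2,
      (∏ i, p (x i)) - 1 / (M * η) ^ 2 * ((∏ i, p (x i)) * (∑ i, (((x i : ℕ) : ℝ) - p 1)) ^ 2)
        ≤ if |(∑ i, ((x i : ℕ) : ℝ)) / M - p 1| ≤ η then ∏ i, p (x i) else 0 := by
    intro x
    have hpx : 0 ≤ ∏ i, p (x i) := Finset.prod_nonneg fun i _ => hp0 _
    split_ifs with h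
    · have : 0 ≤ 1 / (M * η) ^ 2 * ((∏ i, p (x i)) * (∑ i, (((x i : ℕ) : ℝ) - p 1)) ^ 2) := by
        positivity
      linarith
    · have hS : ∑ i, (((x i : ℕ) : ℝ) - p 1) = M * ((∑ i, ((x i : ℕ) : ℝ)) / M - p 1) := by
        rw [Finset.sum_sub_distrib]
        simp
        field_simp
      have h' : η ^ 2 ≤ ((∑ i, ((x i : ℕ) : ℝ)) / M - p 1) ^ 2 := by
        rw [← sq_abs ((∑ i, ((x i : ℕ) : ℝ)) / M - p 1)]
        have := not_le.1 h
        gcongr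
      rw [hS, sub_nonpos]
      have : 1 ≤ 1 / (M * η) ^ 2 * (M * ((∑ i, ((x i : ℕ) : ℝ)) / M - p 1)) ^ 2 := by
        rw [one_div_mul_eq_div, le_div_iff₀ (by positivity), mul_pow, mul_pow, one_mul]
        gcongr
      calc ∏ i, p (x i) = (∏ i, p (x i)) * 1 := (mul_one _).symm
        _ ≤ (∏ i, p (x i)) * (1 / (M * η) ^ 2
            * (M * ((∑ i, ((x i : ℕ) : ℝ)) / M - p 1)) ^ 2) := by gcongr
        _ = _ := by ring
  have hsum := Finset.sum_le_sum fun x (_ : x ∈ Finset.univ) => hterm x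
  rw [Finset.sum_sub_distrib, ← Finset.mul_sum, h0, h2] at hsum
  have hb : 1 / (M * η) ^ 2 * (M * ∑ r, p r * (((r : ℕ) : ℝ) - p 1) ^ 2)
      ≤ 1 / (4 * M * η ^ 2) := by
    calc _ ≤ 1 / (M * η) ^ 2 * (M * (1 / 4)) := by gcongr
      _ = _ := by field_simp
  rw [iidProb]
  refine (sub_le_sub_left hb 1).trans (hsum.trans (le_of_eq ?_))
  refine Finset.sum_congr rfl fun x _ => ?_
  congr

theorem iidProb_mono (M : ℕ) (p : R → ℝ) (hp : ∀ r, 0 ≤ p r) {E F : (Fin M → R) → Prop}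
    (h : ∀ x, E x → F x) : iidProb M p E ≤ iidProb M p F := by
  classical
  refine Finset.sum_le_sum fun x _ => ?_
  have hpx : 0 ≤ ∏ i, p (x i) := Finset.prod_nonneg fun i _ => hp _
  by_cases hE : E x
  · rw [if_pos hE, if_pos (h x hE)]
  · rw [if_neg hE]
    split_ifs <;> simp [hpx]

end IID

/-- The unitary that permutes the basis states. -/
def permGate {ι : Type} [Fintype ι] [DecidableEq ι] (σ : Equiv.Perm ι) :
    Matrix.unitaryGroup ι ℂ :=
  ⟨(1 : Matrix ι ι ℂ).submatrix σ id, by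
    rw [Matrix.mem_unitaryGroup_iff, Matrix.star_eq_conjTranspose, conjTranspose_submatrix,
      conjTranspose_one]
    ext i j
    simp [mul_apply, one_apply]⟩

theorem permGate_mulVec {ι : Type} [Fintype ι] [DecidableEq ι] (σ : Equiv.Perm ι) (ψ : ι → ℂ) :
    (permGate σ).1 *ᵥ ψ = ψ ∘ σ := by
  funext x
  simp [permGate, mulVec, dotProduct, one_apply]

/-! ### Qubitization of a self-inverse operator -/

section Walk

variable {W O : Type} [Fintype W] [DecidableEq W] [Fintype O] [DecidableEq O] [Zero O]

/-- The isometry that adjoins the register `O` in the state `|0⟩`. -/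
def adjoinZero (W O : Type) [DecidableEq W] [DecidableEq O] [Zero O] : Matrix (W × O) W ℂ :=
  fun x w => if x = (w, 0) then 1 else 0

omit [Fintype O] in
theorem adjoinZero_mulVec (v : W → ℂ) :
    adjoinZero W O *ᵥ v = fun x => if x.2 = 0 then v x.1 else 0 := by
  funext x
  obtain ⟨w, o⟩ := x
  by_cases h : o = 0 <;> simp [adjoinZero, mulVec, dotProduct, h]

theorem mul_adjoinZero_apply {α : Type} (M : Matrix α (W × O) ℂ) (i : α) (w : W) :
    (M * adjoinZero W O) i w = M i (w, 0) := by
  simp [adjoinZero, mul_apply]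

theorem adjoinZero_conjTranspose_mul_apply {α : Type} (M : Matrix (W × O) α ℂ) (i : α) (w : W) :
    ((adjoinZero W O)ᴴ * M) w i = M (w, 0) i := by
  simp [adjoinZero, mul_apply, conjTranspose_apply]

theorem adjoinZero_isometry : (adjoinZero W O)ᴴ * adjoinZero W O = 1 := by
  ext w w'
  rw [adjoinZero_conjTranspose_mul_apply]
  simp [adjoinZero, one_apply]

omit [Fintype O] in
theorem adjoinZero_mul_conjTranspose :
    adjoinZero W O * (adjoinZero W O)ᴴ = diagonal fun x => if x.2 = 0 then 1 else 0 := by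
  ext x y
  obtain ⟨w, o⟩ := x
  obtain ⟨w', o'⟩ := y
  rw [mul_apply, Finset.sum_eq_single w]
  · by_cases h : o = 0
    · subst h
      by_cases h2 : (w, (0 : O)) = (w', o')
      · rw [← h2]
        simp [adjoinZero]
      · rw [diagonal_apply_ne _ h2]
        simp only [adjoinZero, conjTranspose_apply, if_neg (Ne.symm h2)]
        simp
    · simp [adjoinZero, diagonal_apply, h]
  · intro v _ hv
    simp [adjoinZero, Ne.symm hv]
  · simp

theorem signGate_ne_zero_eq :
    (signGate fun x : W × O => x.2 ≠ 0).1
      = (2 : ℂ) • (adjoinZero W O * (adjoinZero W O)ᴴ) - 1 := by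
  rw [adjoinZero_mul_conjTranspose]
  ext x y
  by_cases h : x = y
  · subst h
    by_cases h2 : x.2 = 0 <;> simp [signGate, h2]
    norm_num
  · simp [signGate, h]

theorem signGate_eq_zero_eq :
    (signGate fun x : W × O => x.2 = 0).1
      = 1 - (2 : ℂ) • (adjoinZero W O * (adjoinZero W O)ᴴ) := by
  rw [adjoinZero_mul_conjTranspose]
  ext x y
  by_cases h : x = y
  · subst h
    by_cases h2 : x.2 = 0 <;> simp [signGate, h2]
    norm_num
  · simp [signGate, h]

/-- Qubitization: the powers of the walk `V (2 J Jᴴ - 1)` of a self-inverse `V` encode the Chebyshev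
polynomials of the block of `V`. -/
theorem walk_pow_block {α β : Type} [Fintype α] [DecidableEq α] [Fintype β] [DecidableEq β]
    (J : Matrix α β ℂ) (hJ : Jᴴ * J = 1) (V : Matrix α α ℂ) (hV : V * V = 1) (k : ℕ) :
    Jᴴ * (V * ((2 : ℂ) • (J * Jᴴ) - 1)) ^ k * J
      = Polynomial.aeval (Jᴴ * V * J) (Polynomial.Chebyshev.T ℝ k) := by
  set Z : Matrix α α ℂ := (2 : ℂ) • (J * Jᴴ) - 1 with hZ
  have hZJ : Z * J = J := by
    rw [hZ, Matrix.sub_mul, Matrix.smul_mul, Matrix.mul_assoc, hJ, Matrix.mul_one, Matrix.one_mul,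
      two_smul, add_sub_cancel_right]
  have hJZ : Jᴴ * Z = Jᴴ := by
    rw [hZ, Matrix.mul_sub, Matrix.mul_smul, ← Matrix.mul_assoc, hJ, Matrix.one_mul,
      Matrix.mul_one, two_smul, add_sub_cancel_right]
  have hZZ : Z * Z = 1 := by
    nth_rw 2 [hZ]
    rw [Matrix.mul_sub, Matrix.mul_smul, ← Matrix.mul_assoc, hZJ, Matrix.mul_one, hZ]
    abel
  have hinv : Z * V * (V * Z) = 1 := by
    rw [Matrix.mul_assoc, ← Matrix.mul_assoc V V, hV, Matrix.one_mul, hZZ]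
  -- The inverse of the walk `V Z` is `Z V`. Since `Jᴴ Z = Jᴴ`, compressing the walk plus its
  -- inverse gives twice the block of `V`, which is the three-term recurrence of the Chebyshev
  -- polynomials.
  have hsum : Jᴴ * (V * Z + Z * V) = (2 : ℂ) • (Jᴴ * V * J * Jᴴ) := by
    rw [Matrix.mul_add, ← Matrix.mul_assoc Jᴴ Z, hJZ, ← Matrix.mul_assoc, hZ, Matrix.mul_sub,
      Matrix.mul_one, sub_add_cancel, Matrix.mul_smul]
    simp only [Matrix.mul_assoc]
  induction k using Nat.twoStepInduction with
  | zero => simp [hJ]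
  | one =>
    simp only [pow_one, Nat.cast_one, Polynomial.Chebyshev.T_one, Polynomial.aeval_X]
    rw [Matrix.mul_assoc, Matrix.mul_assoc V, hZJ, Matrix.mul_assoc]
  | more k ih1 ih2 =>
    have hT : Polynomial.Chebyshev.T ℝ ((k + 2 : ℕ) : ℤ)
        = 2 * Polynomial.X * Polynomial.Chebyshev.T ℝ ((k + 1 : ℕ) : ℤ)
          - Polynomial.Chebyshev.T ℝ (k : ℤ) := by
      push_cast
      exact Polynomial.Chebyshev.T_add_two ℝ k
    rw [hT, map_sub, map_mul, map_mul, Polynomial.aeval_X, ← ih1, ← ih2, map_ofNat, eq_sub_iff_add_eq]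
    have h1 : (V * Z) ^ (k + 2) = (V * Z) * (V * Z) ^ (k + 1) := pow_succ' _ _
    have h2 : (V * Z) ^ k = (Z * V) * (V * Z) ^ (k + 1) := by
      rw [pow_succ' (V * Z) k, ← Matrix.mul_assoc (Z * V), hinv, Matrix.one_mul]
    rw [h1, h2, ← Matrix.add_mul, ← Matrix.mul_add, ← Matrix.add_mul, ← Matrix.mul_assoc Jᴴ, hsum]
    have h3 : (2 : Matrix β β ℂ) = (2 : ℂ) • (1 : Matrix β β ℂ) := by
      rw [two_smul, one_add_one_eq_two]
    rw [h3]
    simp only [Matrix.smul_mul, Matrix.mul_assoc, Matrix.one_mul]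

end Walk

/-! ### Block encoding of the density matrix and its walk -/

section BlockEncoding

variable {A B : Type} [Fintype A] [DecidableEq A] [Fintype B] [DecidableEq B]

/-- Exchange of the first components of two pairs. -/
def swapFst (A B : Type) : Equiv.Perm ((A × B) × (A × B)) where
  toFun x := ((x.2.1, x.1.2), (x.1.1, x.2.2))
  invFun x := ((x.2.1, x.1.2), (x.1.1, x.2.2))
  left_inv _ := rfl
  right_inv _ := rfl

/-- The block encoding of the density matrix of a purified oracle: the oracle, an exchange of `A`
with its copy in the workspace, and the inverse oracle. -/
def blockEncoding (A B : Type) [Fintype A] [DecidableEq A] [Fintype B] [DecidableEq B] :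
    Circuit (A × B) (A × B) :=
  [Step.query, Step.gate (permGate (swapFst A B)), Step.queryInv]

theorem queries_blockEncoding : Circuit.queries (blockEncoding A B) = 2 := rfl

theorem eval_blockEncoding (U : Matrix.unitaryGroup (A × B) ℂ) :
    Circuit.eval U (blockEncoding A B)
      = ((1 : Matrix (A × B) (A × B) ℂ) ⊗ₖ (star U).1) * (permGate (swapFst A B)).1
        * ((1 : Matrix (A × B) (A × B) ℂ) ⊗ₖ U.1) := by
  simp [blockEncoding, Circuit.eval, Step.eval]

theorem star_eval_blockEncoding (U : Matrix.unitaryGroup (A × B) ℂ) :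
    star (Circuit.eval U (blockEncoding A B)) = Circuit.eval U (blockEncoding A B) := by
  have h : star (permGate (swapFst A B)).1 = (permGate (swapFst A B)).1 := by
    rw [Matrix.star_eq_conjTranspose]
    ext x y
    simp only [permGate, conjTranspose_submatrix, conjTranspose_one, submatrix_apply, id,
      one_apply]
    congr 1
    exact propext ⟨fun h => by rw [h]; rfl, fun h => by rw [← h]; rfl⟩
  rw [eval_blockEncoding, star_mul, star_mul, h]
  simp only [Matrix.star_eq_conjTranspose, conjTranspose_kronecker, conjTranspose_one,
    Unitary.coe_star, conjTranspose_conjTranspose, Matrix.mul_assoc]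

variable [Zero A] [Zero B]

/-- From the workspace state `|a', b'⟩` the query prepares `Ψ` and the exchange puts `a'` into its
`A` part. The overlap with `⟨a, b|` and with `Ψ` is `∑ Ψ(a, ·) conj Ψ(a', ·)`, an entry of `ρ`. The
copy of `B` is a spectator, present because the workspace later holds the purification. -/
theorem blockEncoding_block (U : Matrix.unitaryGroup (A × B) ℂ) :
    (adjoinZero (A × B) (A × B))ᴴ * Circuit.eval U (blockEncoding A B)
        * adjoinZero (A × B) (A × B)
      = partialTraceB (vecMulVec (fun x => U.1 x 0) (star fun x => U.1 x 0))
        ⊗ₖ (1 : Matrix B B ℂ) := by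
  ext x y
  have hv : ((1 : Matrix (A × B) (A × B) ℂ) ⊗ₖ U.1) *ᵥ Pi.single (y, 0) 1
      = fun z => if z.1 = y then U.1 z.2 0 else 0 := by
    funext z
    simp [kroneckerMap_apply, one_apply]
  rw [mul_adjoinZero_apply, adjoinZero_conjTranspose_mul_apply]
  have h : Circuit.eval U (blockEncoding A B) (x, 0) (y, 0)
      = (Circuit.eval U (blockEncoding A B) *ᵥ Pi.single (y, 0) 1) (x, 0) := by simp
  rw [h, eval_blockEncoding, ← mulVec_mulVec, ← mulVec_mulVec, hv, permGate_mulVec,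
    one_kronecker_mulVec, kroneckerMap_apply]
  simp only [mulVec, dotProduct, Function.comp_apply, swapFst, Equiv.coe_fn_mk, Fintype.sum_prod_type, partialTraceB, vecMulVec_apply,
    Pi.star_apply, one_apply, Unitary.coe_star, star_apply, Prod.ext_iff]
  rw [Finset.sum_eq_single y.1]
  · by_cases hb : x.2 = y.2 <;> simp [hb, mul_comm]
  · intro a _ ha
    simp [ha]
  · simp

/-- The walk operator whose powers encode the Chebyshev polynomials of `1 - 2 ρ ^ 2`. -/
noncomputable def walk (U : Matrix.unitaryGroup (A × B) ℂ) :
    Matrix ((A × B) × (A × B)) ((A × B) × (A × B)) ℂ :=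
  Circuit.eval U (blockEncoding A B) * (signGate fun x : (A × B) × (A × B) => x.2 = 0).1
    * star (Circuit.eval U (blockEncoding A B))
    * (signGate fun x : (A × B) × (A × B) => x.2 ≠ 0).1

theorem walk_mem (U : Matrix.unitaryGroup (A × B) ℂ) : walk U ∈ Matrix.unitaryGroup _ ℂ :=
  mul_mem (mul_mem (mul_mem (Circuit.eval_mem U _) (signGate _).2)
    (Unitary.star_mem (Circuit.eval_mem U _))) (signGate _).2

/-- With `E` the block encoding, `V = E (1 - 2 J Jᴴ) E` squares to 1 and has block `1 - 2 (Jᴴ E J)²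
= (1 - 2ρ²) ⊗ 1`, so the qubitization lemma applies. The argument `1 - 2x² = cos φ`, where `x = sin
(φ / 2)`, is the one that the logarithmic series needs. -/
theorem walk_pow_eq (U : Matrix.unitaryGroup (A × B) ℂ) (ρ : Matrix A A ℂ)
    (hρ : partialTraceB (vecMulVec (fun x => U.1 x 0) (star fun x => U.1 x 0)) = ρ) (k : ℕ) :
    (adjoinZero (A × B) (A × B))ᴴ * walk U ^ k * adjoinZero (A × B) (A × B)
      = Polynomial.aeval (1 - 2 * ρ ^ 2) (Polynomial.Chebyshev.T ℝ k) ⊗ₖ (1 : Matrix B B ℂ) := by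
  set J := adjoinZero (A × B) (A × B) with hJdef
  have hJ : Jᴴ * J = 1 := adjoinZero_isometry
  set E := Circuit.eval U (blockEncoding A B) with hE
  have hEE : E * E = 1 := by
    have := Matrix.mem_unitaryGroup_iff.1 (Circuit.eval_mem U (blockEncoding A B))
    rwa [star_eval_blockEncoding] at this
  have hblock : Jᴴ * E * J = ρ ⊗ₖ (1 : Matrix B B ℂ) := by
    rw [← hρ]
    exact blockEncoding_block U
  set V := E * (signGate fun x : (A × B) × (A × B) => x.2 = 0).1 * E with hV
  have hSS : (signGate fun x : (A × B) × (A × B) => x.2 = 0).1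
      * (signGate fun x : (A × B) × (A × B) => x.2 = 0).1 = 1 := by
    simp only [signGate, diagonal_mul_diagonal]
    rw [← diagonal_one]
    congr 1
    funext x
    split_ifs <;> simp
  have hVV : V * V = 1 := by
    rw [hV, Matrix.mul_assoc, ← Matrix.mul_assoc E (E * _), ← Matrix.mul_assoc E E, hEE,
      Matrix.one_mul, ← Matrix.mul_assoc, Matrix.mul_assoc E, hSS, Matrix.mul_one, hEE]
  have hVb : Jᴴ * V * J = (1 - 2 * ρ ^ 2) ⊗ₖ (1 : Matrix B B ℂ) := by
    have e1 : Jᴴ * V * J = 1 - (2 : ℂ) • ((Jᴴ * E * J) * (Jᴴ * E * J)) := by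
      rw [hV, signGate_eq_zero_eq, ← hJdef]
      simp only [Matrix.mul_sub, Matrix.sub_mul, Matrix.mul_smul, Matrix.smul_mul, Matrix.mul_one,
        hEE, Matrix.mul_assoc, hJ]
    have e2 : (2 : Matrix A A ℂ) = (2 : ℂ) • (1 : Matrix A A ℂ) := by
      rw [two_smul, one_add_one_eq_two]
    have e3 : ∀ M N : Matrix A A ℂ, (M - N) ⊗ₖ (1 : Matrix B B ℂ)
        = M ⊗ₖ (1 : Matrix B B ℂ) - N ⊗ₖ (1 : Matrix B B ℂ) := by
      intro M N
      ext
      simp [sub_mul]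
    rw [e1, hblock, ← mul_kronecker_mul, Matrix.mul_one, e3, one_kronecker_one, e2,
      Matrix.smul_mul, Matrix.one_mul, smul_kronecker, pow_two]
  have hwalk : walk U = V * ((2 : ℂ) • (J * Jᴴ) - 1) := by
    rw [walk, star_eval_blockEncoding, signGate_ne_zero_eq]
  rw [hwalk, walk_pow_block J hJ V hVV, hVb]
  have hhom : ∀ (P : Polynomial ℝ) (M : Matrix A A ℂ),
      Polynomial.aeval (M ⊗ₖ (1 : Matrix B B ℂ)) P
        = Polynomial.aeval M P ⊗ₖ (1 : Matrix B B ℂ) := by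
    intro P M
    have hpow : ∀ m : ℕ, (M ⊗ₖ (1 : Matrix B B ℂ)) ^ m = (M ^ m) ⊗ₖ (1 : Matrix B B ℂ) := by
      intro m
      induction m with
      | zero => simp
      | succ m ih => rw [pow_succ, pow_succ, ih, ← mul_kronecker_mul, Matrix.mul_one]
    induction P using Polynomial.induction_on' with
    | add p q hp hq => rw [map_add, map_add, hp, hq, add_kronecker]
    | monomial m a =>
      simp only [Polynomial.aeval_monomial, hpow, Algebra.algebraMap_eq_smul_one, Matrix.smul_mul,
        Matrix.one_mul, smul_kronecker]
  exact hhom _ _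

/-- The expectation of the walk in the purification is a trace against the density matrix. -/
theorem walk_pow_expectation (U : Matrix.unitaryGroup (A × B) ℂ) (ρ : Matrix A A ℂ)
    (hρ : partialTraceB (vecMulVec (fun x => U.1 x 0) (star fun x => U.1 x 0)) = ρ) (k : ℕ) :
    star (adjoinZero (A × B) (A × B) *ᵥ fun x => U.1 x 0)
        ⬝ᵥ (walk U ^ k *ᵥ (adjoinZero (A × B) (A × B) *ᵥ fun x => U.1 x 0))
      = (ρ * Polynomial.aeval (1 - 2 * ρ ^ 2) (Polynomial.Chebyshev.T ℝ k)).trace := by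
  set Ψ : A × B → ℂ := fun x => U.1 x 0
  rw [star_mulVec, ← dotProduct_mulVec, mulVec_mulVec, mulVec_mulVec,
    walk_pow_eq U ρ hρ k, trace_mul_comm]
  generalize Polynomial.aeval (1 - 2 * ρ ^ 2) (Polynomial.Chebyshev.T ℝ (k : ℤ)) = Y
  simp only [trace, diag, mul_apply, dotProduct, mulVec, Fintype.sum_prod_type, kroneckerMap_apply]
  rw [← hρ]
  simp only [partialTraceB, vecMulVec_apply, Finset.mul_sum, one_apply, mul_ite, mul_one, mul_zero,
    ite_mul, zero_mul, Finset.sum_ite_eq, Finset.mem_univ, if_true]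
  refine Finset.sum_congr rfl fun a _ => ?_
  rw [Finset.sum_comm]
  refine Finset.sum_congr rfl fun a' _ => Finset.sum_congr rfl fun b _ => ?_
  simp only [Pi.star_apply]
  ring

end BlockEncoding

/-- Every real unit vector is the image of a basis state under some unitary. -/
theorem exists_unitary_col {ι : Type} [Fintype ι] [DecidableEq ι] (i₀ : ι) (u : ι → ℝ)
    (hu : ∑ i, u i ^ 2 = 1) :
    ∃ P : Matrix.unitaryGroup ι ℂ, ∀ i, P.1 i i₀ = u i := by
  have hnorm : ‖(WithLp.toLp 2 (fun i => (u i : ℂ)) : EuclideanSpace ℂ ι)‖ = 1 := by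
    rw [EuclideanSpace.norm_eq, Real.sqrt_eq_one]
    simpa using hu
  have ho : Orthonormal ℂ (({i₀} : Set ι).domRestrict
      (fun _ : ι => (WithLp.toLp 2 (fun i => (u i : ℂ)) : EuclideanSpace ℂ ι))) := by
    refine ⟨fun _ => hnorm, fun i j hij => absurd (Subsingleton.elim i j) hij⟩
  obtain ⟨b, hb⟩ := ho.exists_orthonormalBasis_extension_of_card_eq (by simp)
  refine ⟨⟨(EuclideanSpace.basisFun ι ℂ).toBasis.toMatrix b,
    OrthonormalBasis.toMatrix_orthonormalBasis_mem_unitary _ _⟩, fun i => ?_⟩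
  simp [Module.Basis.toMatrix_apply, hb i₀ rfl]

/-! ### The Hadamard test of a superposition of walk powers -/

section EntropyCircuit

variable {K A B : Type} [Fintype K] [DecidableEq K] [Fintype A] [DecidableEq A]
  [Fintype B] [DecidableEq B] [Zero K] [Zero A] [Zero B]

theorem fourierMatrix_two_one (f : Fin 2) :
    fourierMatrix 2 1 f = (if f = 0 then 1 else -1) / (Real.sqrt 2 : ℂ) := by
  have : Complex.exp (2 * Real.pi * Complex.I / 2) = -1 := by
    rw [mul_assoc, mul_div_assoc, mul_div_cancel₀ _ two_ne_zero, Complex.exp_pi_mul_I]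
  fin_cases f <;> simp [fourierMatrix, this]

/-- The Hadamard gate on the flag of a control register. -/
noncomputable def flagHadamard (K : Type) [Fintype K] [DecidableEq K] :
    Matrix.unitaryGroup (Fin 2 × K) ℂ :=
  ⟨fourierMatrix 2 ⊗ₖ (1 : Matrix K K ℂ),
    Matrix.kronecker_mem_unitary (fourierMatrix_mem 2) (one_mem _)⟩

/-- The Hadamard test of a superposition of powers of the walk: the control register is prepared by
`P`, and `cnt k` powers of the walk are applied if the flag is set and the index is `k`. -/
noncomputable def hadamardTest (P : Matrix.unitaryGroup (Fin 2 × K) ℂ) (cnt : K → ℕ) (m : ℕ) :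
    Circuit ((Fin 2 × K) × (A × B)) (A × B) :=
  [Step.query] ++ [Step.gate (extendGate (Fin 2 × K) (permGate (Equiv.prodComm (A × B) (A × B))))]
    ++ [Step.gate (onControl P)]
    ++ (List.range m).flatMap (fun i => controlledReflections
      (fun r : Fin 2 × K => i < if r.1 = 1 then cnt r.2 else 0)
      (fun x : (A × B) × (A × B) => x.2 ≠ 0) (fun x => x.2 = 0) (blockEncoding A B))
    ++ [Step.gate (onControl (flagHadamard K))]

omit [Zero K] in
theorem queries_hadamardTest (P : Matrix.unitaryGroup (Fin 2 × K) ℂ) (cnt : K → ℕ) (m : ℕ) :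
    Circuit.queries (hadamardTest P cnt m : Circuit ((Fin 2 × K) × (A × B)) (A × B))
      = 1 + m * 4 := by
  rw [hadamardTest]
  simp only [Circuit.queries_append]
  rw [Circuit.queries_flatMap_range _ 4]
  · simp [Circuit.queries, Step.cost]
  · intro i
    rw [queries_controlledReflections, queries_blockEncoding]

theorem slice_hadamardTest (U : Matrix.unitaryGroup (A × B) ℂ)
    (P : Matrix.unitaryGroup (Fin 2 × K) ℂ) (cnt : K → ℕ) (m : ℕ) (hm : ∀ k, cnt k ≤ m) (k : K) :
    slice (1, k) (Circuit.eval U (hadamardTest P cnt m) *ᵥ Pi.single 0 1)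
      = (1 / (Real.sqrt 2 : ℂ)) •
        (P.1 (0, k) 0 • (adjoinZero (A × B) (A × B) *ᵥ fun x => U.1 x 0)
          - P.1 (1, k) 0 • (walk U ^ cnt k *ᵥ
            (adjoinZero (A × B) (A × B) *ᵥ fun x => U.1 x 0))) := by
  rw [hadamardTest]
  simp only [Circuit.eval_append, Circuit.eval_singleton, Step.eval]
  rw [← mulVec_mulVec, ← mulVec_mulVec, ← mulVec_mulVec, ← mulVec_mulVec, slice_onControl]
  set Φ : (A × B) × (A × B) → ℂ := adjoinZero (A × B) (A × B) *ᵥ fun x => U.1 x 0 with hΦ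
  -- The query prepares the purification in the oracle register. The exchange moves it to the
  -- workspace and leaves the oracle register in `|0⟩`, as the block encoding requires.
  have hprep : ∀ r : Fin 2 × K, slice r ((onControl P).1 *ᵥ
      ((extendGate (Fin 2 × K) (permGate (Equiv.prodComm (A × B) (A × B)))).1 *ᵥ
        (((1 : Matrix ((Fin 2 × K) × (A × B)) ((Fin 2 × K) × (A × B)) ℂ) ⊗ₖ U.1)
          *ᵥ Pi.single 0 1))) = P.1 r 0 • Φ := by
    intro r
    rw [slice_onControl, Finset.sum_eq_single 0]
    · rw [slice_extendGate, slice_one_kronecker, slice_single_zero, if_pos rfl, permGate_mulVec]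
      congr 1
      funext x
      rw [hΦ, adjoinZero_mulVec, Function.comp_apply, one_kronecker_mulVec]
      by_cases hx : x.2 = 0
      · have : (fun o => (Pi.single 0 1 : (A × B) × (A × B) → ℂ) ((0 : A × B), o))
            = Pi.single 0 1 := by
          funext o
          simp [Pi.single_apply, Prod.ext_iff]
        simp only [Equiv.prodComm_apply, Prod.fst_swap, Prod.snd_swap, hx, this, if_true]
        simp
      · have : (fun o => (Pi.single 0 1 : (A × B) × (A × B) → ℂ) (x.2, o)) = 0 := by
          funext o
          have : ¬ ((x.2, o) = (0 : (A × B) × (A × B))) := fun h => hx (congrArg Prod.fst h)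
          simp [this]
        simp only [Equiv.prodComm_apply, Prod.fst_swap, Prod.snd_swap, hx, this, if_false,
          mulVec_zero, Pi.zero_apply]
    · intro r' _ hr'
      rw [slice_extendGate, slice_one_kronecker, slice_single_zero, if_neg hr']
      simp
    · simp
  have hslice := slice_flatMap_range U (fun i => controlledReflections
      (fun r : Fin 2 × K => i < if r.1 = 1 then cnt r.2 else 0)
      (fun x : (A × B) × (A × B) => x.2 ≠ 0) (fun x => x.2 = 0) (blockEncoding A B))
    (fun r => if r.1 = 1 then cnt r.2 else 0) (walk U)
    (fun i r ψ => slice_controlledReflections U _ _ _ _ r ψ) m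
  simp only [hslice, hprep]
  rw [Fintype.sum_prod_type, Fin.sum_univ_two]
  simp only [flagHadamard, kroneckerMap_apply, fourierMatrix_two_one, one_apply]
  rw [Finset.sum_eq_single k, Finset.sum_eq_single k]
  · have := hm k
    simp only [if_true, mul_one, one_ne_zero, if_false, zero_ne_one, Nat.min_zero, pow_zero,
      one_mulVec, min_eq_right this, mulVec_smul]
    module
  all_goals simp +contextual [eq_comm]

theorem sum_norm_sq_mul_sub {ι : Type} [Fintype ι] [DecidableEq ι] (Φ : ι → ℂ) (G : Matrix ι ι ℂ)
    (hG : G ∈ Matrix.unitaryGroup ι ℂ) (hΦ : ∑ x, ‖Φ x‖ ^ 2 = 1) :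
    ∑ x, ‖Φ x - (G *ᵥ Φ) x‖ ^ 2 = 2 - 2 * (star Φ ⬝ᵥ (G *ᵥ Φ)).re := by
  have h : ∀ x, ‖Φ x - (G *ᵥ Φ) x‖ ^ 2
      = ‖Φ x‖ ^ 2 + ‖(G *ᵥ Φ) x‖ ^ 2 - 2 * (star (Φ x) * (G *ᵥ Φ) x).re := by
    intro x
    rw [← Complex.normSq_eq_norm_sq, ← Complex.normSq_eq_norm_sq, ← Complex.normSq_eq_norm_sq,
      Complex.normSq_sub]
    simp [Complex.mul_re]
  rw [Finset.sum_congr rfl fun x _ => h x, Finset.sum_sub_distrib, Finset.sum_add_distrib,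
    sum_norm_sq_mulVec hG, hΦ, ← Finset.mul_sum, dotProduct, Complex.re_sum]
  norm_num

/-- The branch with flag 1 and index `k` holds `√(q k) / 2` times the difference of `Φ` and its
image under the walk power. Its squared norm is `q k (1 - Re ⟨Φ, walk ^ cnt k Φ⟩) / 2`. -/
theorem sum_outcomeProb_hadamardTest (U : Matrix.unitaryGroup (A × B) ℂ) (ρ : Matrix A A ℂ)
    (hρ : partialTraceB (vecMulVec (fun x => U.1 x 0) (star fun x => U.1 x 0)) = ρ)
    (P : Matrix.unitaryGroup (Fin 2 × K) ℂ) (q : K → ℝ) (hq : ∀ k, 0 ≤ q k)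
    (hP : ∀ f k, P.1 (f, k) 0 = Real.sqrt (q k / 2))
    (cnt : K → ℕ) (m : ℕ) (hm : ∀ k, cnt k ≤ m) :
    ∑ k, outcomeProb (hadamardTest P cnt m : Circuit ((Fin 2 × K) × (A × B)) (A × B)) U (1, k)
      = ∑ k, q k * ((1 - (ρ * Polynomial.aeval (1 - 2 * ρ ^ 2)
          (Polynomial.Chebyshev.T ℝ (cnt k))).trace.re) / 2) := by
  refine Finset.sum_congr rfl fun k _ => ?_
  rw [outcomeProb_eq_sum_slice, slice_hadamardTest U P cnt m hm k, hP, hP]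
  rw [← walk_pow_expectation U ρ hρ]
  set Φ : (A × B) × (A × B) → ℂ := adjoinZero (A × B) (A × B) *ᵥ fun x => U.1 x 0 with hΦ
  have hΦ1 : ∑ x, ‖Φ x‖ ^ 2 = 1 := by
    have h1 : ∑ x, ‖(U.1 *ᵥ Pi.single 0 1) x‖ ^ 2 = 1 := by
      rw [sum_norm_sq_mulVec U.2, sum_norm_sq_single]
    rw [← h1, hΦ, adjoinZero_mulVec, Fintype.sum_prod_type]
    refine Finset.sum_congr rfl fun x _ => ?_
    rw [Finset.sum_eq_single 0] <;> simp +contextual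
  have hs := sum_norm_sq_mul_sub Φ (walk U ^ cnt k) (pow_mem (walk_mem U) _) hΦ1
  have ht : ∀ x, ‖((1 / (Real.sqrt 2 : ℂ)) • ((Real.sqrt (q k / 2) : ℂ) • Φ
      - (Real.sqrt (q k / 2) : ℂ) • (walk U ^ cnt k *ᵥ Φ))) x‖ ^ 2
      = q k / 4 * ‖Φ x - (walk U ^ cnt k *ᵥ Φ) x‖ ^ 2 := by
    intro x
    rw [Pi.smul_apply, Pi.sub_apply, Pi.smul_apply, Pi.smul_apply, ← smul_sub, norm_smul, norm_smul,
      norm_div, norm_one, Complex.norm_real, Complex.norm_real, Real.norm_eq_abs, Real.norm_eq_abs,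
      mul_pow, mul_pow, div_pow, sq_abs, sq_abs, Real.sq_sqrt zero_le_two,
      Real.sq_sqrt (by have := hq k; positivity)]
    ring
  rw [Finset.sum_congr rfl fun x _ => ht x, ← Finset.mul_sum, hs]
  ring

end EntropyCircuit

/-! ### Relabelling the workspace as a register of qubits -/

section Reindex

variable {W W' O : Type} [Fintype W] [DecidableEq W] [Fintype W'] [DecidableEq W'] [Fintype O]
  [DecidableEq O]

/-- Relabelling of the workspace in one step. -/
def Step.reindex (e : W' ≃ W) : Step W O → Step W' O
  | .gate V => .gate ⟨V.1.submatrix (e.prodCongr (Equiv.refl O)) (e.prodCongr (Equiv.refl O)), by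
      have h := V.2
      rw [Matrix.mem_unitaryGroup_iff, Matrix.star_eq_conjTranspose] at h ⊢
      rw [Matrix.conjTranspose_submatrix, Matrix.submatrix_mul_equiv, h,
        Matrix.submatrix_one_equiv]⟩
  | .query => .query
  | .queryInv => .queryInv

/-- Relabelling of the workspace of a circuit. -/
def Circuit.reindex (e : W' ≃ W) (c : Circuit W O) : Circuit W' O := c.map (Step.reindex e)

theorem Circuit.queries_reindex (e : W' ≃ W) (c : Circuit W O) :
    Circuit.queries (Circuit.reindex e c) = Circuit.queries c := by
  have h : Step.cost ∘ Step.reindex e = (Step.cost : Step W O → ℕ) := by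
    funext s
    cases s <;> rfl
  simp [Circuit.queries, Circuit.reindex, h]

theorem Circuit.eval_reindex (U : Matrix.unitaryGroup O ℂ) (e : W' ≃ W) (c : Circuit W O) :
    Circuit.eval U (Circuit.reindex e c)
      = (Circuit.eval U c).submatrix (e.prodCongr (Equiv.refl O)) (e.prodCongr (Equiv.refl O)) := by
  have hone : ∀ M : Matrix O O ℂ, (1 : Matrix W' W' ℂ) ⊗ₖ M
      = ((1 : Matrix W W ℂ) ⊗ₖ M).submatrix (e.prodCongr (Equiv.refl O))
        (e.prodCongr (Equiv.refl O)) := by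
    intro M
    ext x y
    simp [kroneckerMap_apply, one_apply]
  induction c with
  | nil => exact (Matrix.submatrix_one_equiv _).symm
  | cons s c ih =>
    have h : Circuit.reindex e (s :: c) = s.reindex e :: Circuit.reindex e c := rfl
    rw [h, Circuit.eval, ih, Circuit.eval, ← Matrix.submatrix_mul_equiv _ _ _
      (e.prodCongr (Equiv.refl O))]
    congr 1
    cases s with
    | gate V => rfl
    | query => exact hone _
    | queryInv => exact hone _

end Reindex

/-- The label 0 must be kept because circuits start in that basis state. -/
theorem exists_equiv_map_zero {α β : Type} [Fintype α] [Fintype β] [DecidableEq β] [Zero α]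
    [Zero β] (h : Fintype.card α = Fintype.card β) : ∃ e : α ≃ β, e 0 = 0 :=
  ⟨(Fintype.equivOfCardEq h).trans (Equiv.swap (Fintype.equivOfCardEq h 0) 0), by simp⟩

/-- A Hadamard test on registers of qubits whose flag probability averages, with weights `q`, the
expectations of the Chebyshev polynomials of `1 - 2 ρ ^ 2`. -/
theorem exists_chebyshev_circuit (n n' d : ℕ) (q : Reg d → ℝ) (hq : ∀ k, 0 ≤ q k)
    (hq1 : ∑ k, q k = 1) :
    ∃ (w : ℕ) (c : Circuit (Fin 2 × Reg w) (Reg n × Reg n')),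
      Circuit.queries c = 1 + 2 ^ d * 4 ∧
      ∀ (ρ : Matrix (Reg n) (Reg n) ℂ) (U : Matrix.unitaryGroup (Reg n × Reg n') ℂ),
        IsPurifiedOracle U ρ →
        outcomeProb c U 1 = ∑ k : Reg d, q k * ((1 - (ρ * Polynomial.aeval (1 - 2 * ρ ^ 2)
          (Polynomial.Chebyshev.T ℝ (((k : ℕ) + 1 : ℕ)))).trace.re) / 2) := by
  obtain ⟨P, hP⟩ := exists_unitary_col (0 : Fin 2 × Reg d) (fun r => Real.sqrt (q r.2 / 2)) (by
    rw [Fintype.sum_prod_type]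
    simp only [Real.sq_sqrt (div_nonneg (hq _) zero_le_two)]
    rw [← Finset.sum_div, hq1]
    simp)
  obtain ⟨e, he⟩ := exists_equiv_map_zero (α := Reg (d + (n + n')))
    (β := Reg d × (Reg n × Reg n')) (by simp [pow_add])
  set E : Fin 2 × Reg (d + (n + n')) ≃ (Fin 2 × Reg d) × (Reg n × Reg n') :=
    (Equiv.prodCongr (Equiv.refl _) e).trans (Equiv.prodAssoc _ _ _).symm with hE
  refine ⟨d + (n + n'), Circuit.reindex E (hadamardTest P (fun k => (k : ℕ) + 1) (2 ^ d)), ?_, ?_⟩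
  · rw [Circuit.queries_reindex, queries_hadamardTest]
  · intro ρ U hρ
    rw [← sum_outcomeProb_hadamardTest U ρ hρ P q hq (fun f k => hP (f, k))
      (fun k => (k : ℕ) + 1) (2 ^ d) (fun k => k.2)]
    have hE0 : E 0 = 0 := by
      have : E 0 = ((0, (e 0).1), (e 0).2) := rfl
      rw [this, he]
      rfl
    simp only [outcomeProb, Circuit.eval_reindex, submatrix_apply]
    rw [← e.symm.sum_comp, Fintype.sum_prod_type]
    refine Finset.sum_congr rfl fun k _ => Finset.sum_congr rfl fun x _ =>
      Finset.sum_congr rfl fun o _ => ?_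
    have h1 : (E.prodCongr (Equiv.refl (Reg n × Reg n'))) ((1, e.symm (k, x)), o)
        = (((1, k), x), o) := by
      simp [hE]
    have h2 : (E.prodCongr (Equiv.refl (Reg n × Reg n'))) 0 = 0 := Prod.ext hE0 rfl
    rw [h1, h2]

/-! ### Traces and entropy through eigenvalues -/

section Spectral

variable {ι : Type} [Fintype ι] [DecidableEq ι] {ρ : Matrix ι ι ℂ}

theorem trace_cfc (hρ : ρ.IsHermitian) (f : ℝ → ℝ) :
    (cfc f ρ).trace = ((∑ i, f (hρ.eigenvalues i) : ℝ) : ℂ) := by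
  rw [hρ.cfc_eq, IsHermitian.cfc, Unitary.conjStarAlgAut_apply, trace_mul_cycle,
    Unitary.coe_star_mul_self, Matrix.one_mul, trace_diagonal]
  simp

theorem trace_mul_cfc (hρ : ρ.IsHermitian) (f : ℝ → ℝ) :
    (ρ * cfc f ρ).trace
      = ((∑ i, hρ.eigenvalues i * f (hρ.eigenvalues i) : ℝ) : ℂ) := by
  -- The spectrum is finite, so every function is continuous on it, including `Real.log` when 0 is
  -- an eigenvalue.
  have hcont : ∀ g : ℝ → ℝ, ContinuousOn g (spectrum ℝ ρ) := fun g =>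
    ρ.finite_real_spectrum.continuousOn g
  have h : ρ * cfc f ρ = cfc (fun x => x * f x) ρ := by
    rw [cfc_mul (fun x => x) f ρ (hcont _) (hcont _), cfc_id' ℝ ρ hρ.isSelfAdjoint]
  rw [h, trace_cfc hρ]

theorem trace_mul_aeval_chebyshev (hρ : ρ.IsHermitian) (k : ℤ) :
    (ρ * Polynomial.aeval (1 - 2 * ρ ^ 2) (Polynomial.Chebyshev.T ℝ k)).trace.re
      = ∑ i, hρ.eigenvalues i
          * (Polynomial.Chebyshev.T ℝ k).eval (1 - 2 * hρ.eigenvalues i ^ 2) := by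
  have h : Polynomial.aeval (1 - 2 * ρ ^ 2) (Polynomial.Chebyshev.T ℝ k)
      = cfc ((Polynomial.Chebyshev.T ℝ k).comp (1 - 2 * Polynomial.X ^ 2)).eval ρ := by
    have h2 : Polynomial.aeval ρ (2 : Polynomial ℝ) = 2 := map_ofNat _ 2
    rw [cfc_polynomial _ ρ hρ.isSelfAdjoint, Polynomial.aeval_comp]
    simp [h2]
  rw [h, trace_mul_cfc hρ, Complex.ofReal_re]
  simp

theorem vonNeumannEntropy_eq (hρ : ρ.IsHermitian) :
    vonNeumannEntropy ρ = -∑ i, hρ.eigenvalues i * Real.log (hρ.eigenvalues i) := by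
  rw [vonNeumannEntropy, trace_mul_cfc hρ, Complex.ofReal_re]

theorem sum_eigenvalues_of_trace_eq_one (hρ : ρ.IsHermitian) (h : ρ.trace = 1) :
    ∑ i, hρ.eigenvalues i = 1 := by
  have := hρ.trace_eq_sum_eigenvalues
  rw [h] at this
  simpa using (congrArg Complex.re this).symm

end Spectral

/-! ### The logarithm as a Chebyshev series -/

section LogSeries

/-- This is the real part of the Taylor series of `-log (1 - z)` at `z = r e^{iφ}`, since `Re log (1
- z) = log |1 - z|`. -/
theorem hasSum_chebyshev_log (r φ : ℝ) (hr0 : 0 ≤ r) (hr1 : r < 1) :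
    HasSum (fun n : ℕ => r ^ (n + 1) / ((n : ℝ) + 1)
        * (Polynomial.Chebyshev.T ℝ ((n + 1 : ℕ))).eval (Real.cos φ))
      (-(Real.log (1 - 2 * r * Real.cos φ + r ^ 2) / 2)) := by
  set z : ℂ := r * Complex.exp (φ * Complex.I) with hz
  have hzn : ‖z‖ = r := by
    rw [hz, norm_mul, Complex.norm_exp_ofReal_mul_I, Complex.norm_real, Real.norm_of_nonneg hr0,
      mul_one]
  have h := Complex.hasSum_re (Complex.hasSum_taylorSeries_neg_log' (hzn.trans_lt hr1))
  convert h using 1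
  · funext n
    have e : z ^ (n + 1) / ((n : ℂ) + 1)
        = ((r ^ (n + 1) / ((n : ℝ) + 1) : ℝ) : ℂ)
          * Complex.exp (((((n + 1 : ℕ) : ℝ) * φ : ℝ) : ℂ) * Complex.I) := by
      rw [hz, mul_pow, ← Complex.exp_nat_mul]
      push_cast
      rw [div_mul_eq_mul_div]
      congr 3
      ring
    rw [e, Complex.re_ofReal_mul, Complex.exp_ofReal_mul_I_re, Polynomial.Chebyshev.T_real_cos]
    norm_cast
  · rw [Complex.neg_re, Complex.log_re]
    have hre : z.re = r * Real.cos φ := by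
      rw [hz, Complex.re_ofReal_mul, Complex.exp_ofReal_mul_I_re]
    have him : z.im = r * Real.sin φ := by
      rw [hz, Complex.im_ofReal_mul, Complex.exp_ofReal_mul_I_im]
    have hn : 1 - 2 * r * Real.cos φ + r ^ 2 = ‖1 - z‖ ^ 2 := by
      rw [← Complex.normSq_eq_norm_sq, Complex.normSq_apply, Complex.sub_re, Complex.sub_im,
        hre, him, Complex.one_re, Complex.one_im]
      linear_combination (-(r ^ 2)) * Real.sin_sq_add_cos_sq φ
    rw [hn, Real.log_pow]
    ring

/-- The truncated series against `-log (2 x)`. -/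
theorem abs_chebyshev_log_sub_le (r x : ℝ) (hr0 : 1 / 2 ≤ r) (hr1 : r < 1) (hx0 : 0 < x)
    (hx1 : x ≤ 1) (D : ℕ) :
    |∑ n ∈ Finset.range D, r ^ (n + 1) / ((n : ℝ) + 1)
        * (Polynomial.Chebyshev.T ℝ ((n + 1 : ℕ))).eval (1 - 2 * x ^ 2) + Real.log (2 * x)|
      ≤ (1 - r) / x + r ^ (D + 1) / (((D : ℝ) + 1) * (1 - r)) := by
  have hr : 0 < r := by linarith
  set φ := Real.arccos (1 - 2 * x ^ 2) with hφ
  have hcos : Real.cos φ = 1 - 2 * x ^ 2 := Real.cos_arccos (by nlinarith) (by nlinarith)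
  have hS := hasSum_chebyshev_log r φ hr.le hr1
  rw [hcos] at hS
  set f : ℕ → ℝ := fun n => r ^ (n + 1) / ((n : ℝ) + 1)
        * (Polynomial.Chebyshev.T ℝ ((n + 1 : ℕ))).eval (1 - 2 * x ^ 2) with hf
  have hfb : ∀ n, |f n| ≤ r ^ (n + 1) / ((n : ℝ) + 1) := by
    intro n
    have : |(Polynomial.Chebyshev.T ℝ ((n + 1 : ℕ))).eval (1 - 2 * x ^ 2)| ≤ 1 := by
      rw [← hcos, Polynomial.Chebyshev.T_real_cos]
      exact Real.abs_cos_le_one _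
    rw [hf, abs_mul, abs_of_nonneg (by positivity)]
    exact mul_le_of_le_one_right (by positivity) this
  have htail := (hasSum_nat_add_iff' D).2 hS
  have hgeo := (hasSum_geometric_of_lt_one hr.le hr1).mul_left (r ^ (D + 1) / ((D : ℝ) + 1))
  have h1 := htail.norm_le_of_bounded hgeo fun n => by
    refine (hfb (n + D)).trans ?_
    rw [div_mul_eq_mul_div, ← pow_add, show n + D + 1 = D + 1 + n by ring]
    gcongr
    linarith [(Nat.cast_nonneg n : (0 : ℝ) ≤ n)]
  rw [Real.norm_eq_abs, ← div_eq_mul_inv, div_div] at h1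
  -- The left side is `(1 - r)² + 4 r x²`. Taking out `(2x)²` isolates the limit `2 log (2x)` and
  -- leaves the error `log (r + s²)`.
  have hy : 1 - 2 * r * (1 - 2 * x ^ 2) + r ^ 2
      = (r + ((1 - r) / (2 * x)) ^ 2) * (2 * x) ^ 2 := by
    field_simp
    ring
  set s := (1 - r) / (2 * x) with hs
  have hs0 : 0 ≤ s := div_nonneg (by linarith) (by linarith)
  have hlog : Real.log (1 - 2 * r * (1 - 2 * x ^ 2) + r ^ 2)
      = Real.log (r + s ^ 2) + 2 * Real.log (2 * x) := by
    rw [hy, Real.log_mul (by positivity) (by positivity), Real.log_pow]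
    norm_num
  have hup : Real.log (r + s ^ 2) ≤ 2 * s := by
    rw [Real.log_le_iff_le_exp (by positivity)]
    have : 1 + s ≤ Real.exp s := by linarith [Real.add_one_le_exp s]
    calc r + s ^ 2 ≤ (1 + s) ^ 2 := by nlinarith
      _ ≤ Real.exp s ^ 2 := by gcongr
      _ = Real.exp (2 * s) := by rw [← Real.exp_nat_mul]; norm_num
  -- Here `r ≥ 1/2` is used. The bound is turned into one by `(1 - r) / x` below, as `x ≤ 1`.
  have hlow : -(2 * (1 - r)) ≤ Real.log (r + s ^ 2) := by
    have h2 : Real.log r ≤ Real.log (r + s ^ 2) := Real.log_le_log hr (by nlinarith)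
    have h3 := Real.one_sub_inv_le_log_of_pos hr
    have h4 : r⁻¹ - 1 ≤ 2 * (1 - r) := by
      rw [sub_le_iff_le_add, inv_le_iff_one_le_mul₀ hr]
      nlinarith
    linarith
  have hsx : 2 * s = (1 - r) / x := by rw [hs]; field_simp
  have hlx : (1 - r) ≤ (1 - r) / x := by
    rw [le_div_iff₀ hx0]
    nlinarith
  rw [hlog] at h1
  have h2 := abs_le.1 h1
  have hnn : 0 ≤ (1 - r) / x := div_nonneg (by linarith) hx0.le
  rw [abs_le]
  constructor <;> linarith [h2.1, h2.2]

end LogSeries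

/-- The entropy from the traces of Chebyshev polynomials. -/
theorem abs_chebyshev_sum_sub_entropy_le {ι : Type} [Fintype ι] [DecidableEq ι]
    (ρ : Matrix ι ι ℂ) (hρ : IsDensityMatrix ρ) (r : ℝ) (hr0 : 1 / 2 ≤ r) (hr1 : r < 1) (D : ℕ) :
    |Real.log 2 + ∑ n ∈ Finset.range D, r ^ (n + 1) / ((n : ℝ) + 1)
        * (ρ * Polynomial.aeval (1 - 2 * ρ ^ 2)
          (Polynomial.Chebyshev.T ℝ ((n + 1 : ℕ)))).trace.re - vonNeumannEntropy ρ|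
      ≤ ρ.rank * (1 - r) + r ^ (D + 1) / (((D : ℝ) + 1) * (1 - r)) := by
  classical
  have hH := hρ.1.isHermitian
  set ev := hH.eigenvalues with hev
  have hev0 : ∀ i, 0 ≤ ev i := hρ.1.eigenvalues_nonneg
  have hsum : ∑ i, ev i = 1 := sum_eigenvalues_of_trace_eq_one hH hρ.2
  have hev1 : ∀ i, ev i ≤ 1 := fun i => by
    rw [← hsum]
    exact Finset.single_le_sum (fun j _ => hev0 j) (Finset.mem_univ i)
  set τ := r ^ (D + 1) / (((D : ℝ) + 1) * (1 - r)) with hτ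
  set F : ℝ → ℝ := fun x => ∑ n ∈ Finset.range D, r ^ (n + 1) / ((n : ℝ) + 1)
        * (Polynomial.Chebyshev.T ℝ ((n + 1 : ℕ))).eval (1 - 2 * x ^ 2) with hF
  have hrank : (ρ.rank : ℝ) = ∑ i, if ev i = 0 then 0 else 1 := by
    rw [hH.rank_eq_card_non_zero_eigs, Fintype.card_subtype, Finset.card_filter]
    push_cast
    refine Finset.sum_congr rfl fun i _ => ?_
    by_cases h : ev i = 0 <;> simp [h, ← hev]
  have hmain : Real.log 2 + ∑ n ∈ Finset.range D, r ^ (n + 1) / ((n : ℝ) + 1)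
        * (ρ * Polynomial.aeval (1 - 2 * ρ ^ 2)
          (Polynomial.Chebyshev.T ℝ ((n + 1 : ℕ)))).trace.re - vonNeumannEntropy ρ
      = ∑ i, ev i * (F (ev i) + (Real.log 2 + Real.log (ev i))) := by
    simp only [trace_mul_aeval_chebyshev hH, vonNeumannEntropy_eq hH, Finset.mul_sum, ← hev]
    rw [Finset.sum_comm]
    simp only [mul_add, Finset.sum_add_distrib, ← Finset.sum_mul, hsum, hF, Finset.mul_sum]
    simp only [mul_left_comm (ev _)]
    ring
  rw [hmain, hrank]
  refine (Finset.abs_sum_le_sum_abs _ _).trans ?_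
  calc ∑ i, |ev i * (F (ev i) + (Real.log 2 + Real.log (ev i)))|
      ≤ ∑ i, ((if ev i = 0 then 0 else 1) * (1 - r) + ev i * τ) := by
        refine Finset.sum_le_sum fun i _ => ?_
        -- A zero eigenvalue contributes nothing, so the error `1 - r` is paid once per unit of
        -- rank.
        by_cases h : ev i = 0
        · simp [h]
        · have hpos : 0 < ev i := lt_of_le_of_ne (hev0 i) (Ne.symm h)
          have hb := abs_chebyshev_log_sub_le r (ev i) hr0 hr1 hpos (hev1 i) D
          rw [Real.log_mul two_ne_zero h] at hb
          rw [abs_mul, abs_of_pos hpos, if_neg h]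
          calc _ ≤ ev i * ((1 - r) / ev i + τ) := by gcongr
            _ = _ := by field_simp
    _ = _ := by rw [Finset.sum_add_distrib, ← Finset.sum_mul, ← Finset.sum_mul, hsum, one_mul]

/-! ### Choice of parameters and query bounds -/

theorem exists_two_pow_between (x : ℝ) (hx : 1 ≤ x) : ∃ d : ℕ, x ≤ 2 ^ d ∧ (2 : ℝ) ^ d ≤ 2 * x := by
  obtain ⟨d, h1, h2⟩ := exists_nat_pow_near hx (one_lt_two : (1 : ℝ) < 2)
  exact ⟨d + 1, h2.le, by rw [pow_succ]; linarith⟩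

/-- A circuit with `O(κ / ε * log (1 / ε))` queries whose flag probability determines the entropy of
every density matrix of rank `κ` up to `ε / 2`. -/
theorem exists_entropy_circuit (n n' κ : ℕ) (ε : ℝ) (hκ : 1 ≤ κ) (hε : 0 < ε) (hε1 : ε < 1) :
    ∃ (w : ℕ) (c : Circuit (Fin 2 × Reg w) (Reg n × Reg n')) (Λ : ℝ),
      0 ≤ Λ ∧ Λ ≤ Real.log (4 * κ / ε) ∧
      (Circuit.queries c : ℝ) ≤ 40 * (κ / ε) * (Real.log (1 / ε) + 2) ∧
      ∀ (ρ : Matrix (Reg n) (Reg n) ℂ) (U : Matrix.unitaryGroup (Reg n × Reg n') ℂ),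
        IsDensityMatrix ρ → ρ.rank = κ → IsPurifiedOracle U ρ →
        |Real.log 2 + Λ * (1 - 2 * outcomeProb c U 1) - vonNeumannEntropy ρ| ≤ ε / 2 := by
  have hκ1 : (1 : ℝ) ≤ κ := by exact_mod_cast hκ
  set ℓ := Real.log (1 / ε) with hℓ
  have hℓ0 : 0 < ℓ := Real.log_pos (by rw [lt_div_iff₀ hε]; linarith)
  have hκε : 1 ≤ κ / ε := by rw [le_div_iff₀ hε]; linarith
  -- This choice makes the regularization error `κ (1 - r)` equal to `ε / 4`.
  set r := 1 - ε / (4 * κ) with hr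
  have hεκ : 0 < ε / (4 * κ) := by positivity
  have hεκ' : ε / (4 * κ) ≤ 1 / 4 := by
    rw [div_le_div_iff₀ (by positivity) (by norm_num)]
    linarith
  have hr0 : 1 / 2 ≤ r := by linarith
  have hr1 : r < 1 := by linarith
  have hr2 : 1 - r = ε / (4 * κ) := by rw [hr]; ring
  obtain ⟨d, hd1, hd2⟩ := exists_two_pow_between (4 * (κ / ε) * (ℓ + 2)) (by nlinarith)
  set Λ := ∑ k ∈ Finset.range (2 ^ d), r ^ (k + 1) / ((k : ℝ) + 1) with hΛ
  have hterm : ∀ k : ℕ, 0 < r ^ (k + 1) / ((k : ℝ) + 1) := fun k => by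
    have : 0 < r := by linarith
    positivity
  have hΛ0 : 0 < Λ := Finset.sum_pos (fun k _ => hterm k) ⟨0, by simp⟩
  -- `Λ` is a partial sum of `-log (1 - r)`, a series of positive terms.
  have hΛB : Λ ≤ Real.log (4 * κ / ε) := by
    have h := Real.hasSum_pow_div_log_of_abs_lt_one (x := r) (by rw [abs_of_pos] <;> linarith)
    have h2 := sum_le_hasSum (Finset.range (2 ^ d)) (fun k _ => (hterm k).le) h
    rwa [hr2, ← Real.log_inv, inv_div] at h2
  set q : Reg d → ℝ := fun k => r ^ ((k : ℕ) + 1) / ((k : ℝ) + 1) / Λ with hq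
  obtain ⟨w, c, hc, hp⟩ := exists_chebyshev_circuit n n' d q
    (fun k => div_nonneg (hterm k).le hΛ0.le) (by
      rw [hq, ← Finset.sum_div, Fin.sum_univ_eq_sum_range (fun k => r ^ (k + 1) / ((k : ℝ) + 1)),
        ← hΛ, div_self hΛ0.ne'])
  refine ⟨w, c, Λ, hΛ0.le, hΛB, ?_, ?_⟩
  · rw [hc]
    push_cast
    nlinarith
  · intro ρ U hρ hrank hU
    have hb := abs_chebyshev_sum_sub_entropy_le ρ hρ r hr0 hr1 (2 ^ d)
    have hflag : Λ * (1 - 2 * outcomeProb c U 1)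
        = ∑ k ∈ Finset.range (2 ^ d), r ^ (k + 1) / ((k : ℝ) + 1)
          * (ρ * Polynomial.aeval (1 - 2 * ρ ^ 2)
            (Polynomial.Chebyshev.T ℝ ((k + 1 : ℕ)))).trace.re := by
      set tr : ℕ → ℝ := fun k => (ρ * Polynomial.aeval (1 - 2 * ρ ^ 2)
        (Polynomial.Chebyshev.T ℝ ((k + 1 : ℕ)))).trace.re
      have hp' : outcomeProb c U 1 = ∑ k : Reg d, q k * ((1 - tr k) / 2) := hp ρ U hU
      change _ = ∑ k ∈ Finset.range (2 ^ d), r ^ (k + 1) / ((k : ℝ) + 1) * tr k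
      rw [← Fin.sum_univ_eq_sum_range (fun k => r ^ (k + 1) / ((k : ℝ) + 1) * tr k) (2 ^ d), hp']
      have e : ∑ k : Reg d, q k = 1 := by
        rw [hq, ← Finset.sum_div, Fin.sum_univ_eq_sum_range (fun k => r ^ (k + 1) / ((k : ℝ) + 1)),
          ← hΛ, div_self hΛ0.ne']
      have h : ∑ k : Reg d, q k * ((1 - tr k) / 2)
          = (∑ k : Reg d, q k - ∑ k : Reg d, q k * tr k) / 2 := by
        rw [← Finset.sum_sub_distrib, Finset.sum_div]
        exact Finset.sum_congr rfl fun k _ => by ring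
      have h' : ∀ y : ℝ, Λ * (1 - 2 * ((1 - y) / 2)) = Λ * y := fun y => by ring
      rw [h, e, h', Finset.mul_sum]
      refine Finset.sum_congr rfl fun k _ => ?_
      simp only [hq]
      field_simp
    rw [hflag]
    refine hb.trans ?_
    rw [hrank, hr2]
    have h1 : (κ : ℝ) * (ε / (4 * κ)) = ε / 4 := by field_simp
    have h2 : ℓ + 2 ≤ 2 ^ d * (ε / (4 * κ)) := by
      calc ℓ + 2 = 4 * (κ / ε) * (ℓ + 2) * (ε / (4 * κ)) := by field_simp
        _ ≤ 2 ^ d * (ε / (4 * κ)) := by gcongr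
    have h3 : r ^ (2 ^ d + 1) ≤ ε / 2 := by
      have hrexp : r ≤ Real.exp (-(ε / (4 * κ))) := Real.one_sub_le_exp_neg _
      have hexp2 : Real.exp (-2) ≤ 1 / 2 := by
        rw [Real.exp_neg, inv_le_comm₀ (Real.exp_pos _) (by norm_num)]
        have := Real.add_one_le_exp 2
        linarith
      calc r ^ (2 ^ d + 1) ≤ r ^ (2 ^ d) :=
            pow_le_pow_of_le_one (by linarith) hr1.le (Nat.le_succ _)
        _ ≤ Real.exp (-(ε / (4 * κ))) ^ (2 ^ d) := pow_le_pow_left₀ (by linarith) hrexp _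
        _ = Real.exp (-(2 ^ d * (ε / (4 * κ)))) := by
            rw [← Real.exp_nat_mul]
            push_cast
            congr 1
            ring
        _ ≤ Real.exp (-ℓ + -2) := Real.exp_le_exp.2 (by linarith)
        _ = ε * Real.exp (-2) := by
            rw [Real.exp_add, hℓ, one_div, Real.log_inv, neg_neg, Real.exp_log hε]
        _ ≤ ε / 2 := by nlinarith
    -- The denominator is at least `ℓ + 2 ≥ 2`: the factor `D + 1` compensates for the small `1 -
    -- r`. Hence a numerator of order `ε` suffices, and the truncation involves `log (1 / ε)`
    -- instead of `log (κ / ε)`.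
    have h4 : r ^ (2 ^ d + 1) / ((((2 ^ d : ℕ) : ℝ) + 1) * (ε / (4 * κ))) ≤ ε / 4 := by
      rw [div_le_iff₀ (by positivity)]
      push_cast
      nlinarith
    linarith

/-- The probability enters the estimate with the factor `2Λ ≤ 2B`, so the precision `ε / (4B)` uses
the remaining `ε / 2`. -/
theorem abs_estimate_sub_le {Λ B p q S ε : ℝ} (hΛ : 0 ≤ Λ) (hΛB : Λ ≤ B) (hB : 0 < B) (hε : 0 < ε)
    (hS : |Real.log 2 + Λ * (1 - 2 * p) - S| ≤ ε / 2) (h : |q - p| ≤ ε / (4 * B)) :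
    |Real.log 2 + Λ * (1 - 2 * q) - S| ≤ ε := by
  have e : Real.log 2 + Λ * (1 - 2 * q) - S
      = (Real.log 2 + Λ * (1 - 2 * p) - S) - 2 * Λ * (q - p) := by ring
  have h2 : |2 * Λ * (q - p)| ≤ ε / 2 := by
    rw [abs_mul, abs_of_nonneg (by positivity)]
    calc 2 * Λ * |q - p| ≤ 2 * B * (ε / (4 * B)) := by gcongr
      _ = ε / 2 := by field_simp; norm_num
  rw [e]
  calc _ ≤ _ := abs_sub _ _
    _ ≤ ε := by linarith

/-- Multiplying the bounds yields only `L²`. The third logarithm is the factor `L / ℓ₀ ≥ 1`. In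
`amplitude_cost_le` the second one arises in the same way. -/
theorem sampling_cost_le {ℓ₀ δ ε k L ℓ a b B M Q : ℝ} (hℓ₀ : 0 < ℓ₀) (hδ : 0 < δ) (hε : 0 < ε)
    (hk : 0 ≤ k) (hb : 0 ≤ b) (hL : ℓ₀ ≤ L) (hℓ : 0 ≤ ℓ) (hB : 0 ≤ B)
    (hBL : B ≤ a * L) (hQ0 : 0 ≤ Q) (hM : M ≤ 8 * B ^ 2 / (δ * ε ^ 2))
    (hQ : Q ≤ 40 * (k / ε) * (b * ℓ)) :
    M * Q ≤ 320 * a ^ 2 * b / (δ * ℓ₀) * (k / ε ^ 3 * L ^ 3 * ℓ) := by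
  have hL0 : 0 < L := hℓ₀.trans_le hL
  calc M * Q ≤ 8 * B ^ 2 / (δ * ε ^ 2) * (40 * (k / ε) * (b * ℓ)) := by gcongr
    _ ≤ 8 * (a * L) ^ 2 / (δ * ε ^ 2) * (40 * (k / ε) * (b * ℓ)) := by gcongr
    _ = 320 * a ^ 2 * b / δ * (k / ε ^ 3 * L ^ 2 * ℓ) * 1 := by field_simp; ring
    _ ≤ 320 * a ^ 2 * b / δ * (k / ε ^ 3 * L ^ 2 * ℓ) * (L / ℓ₀) := by
        gcongr
        rwa [one_le_div hℓ₀]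
    _ = _ := by field_simp

theorem amplitude_cost_le {ℓ₀ δ ε k L ℓ a b B N Q : ℝ} (hℓ₀ : 0 < ℓ₀) (hδ : 0 < δ) (hε : 0 < ε)
    (hk : 0 ≤ k) (ha : 0 ≤ a) (hb : 0 ≤ b) (hL : ℓ₀ ≤ L) (hℓ : 0 ≤ ℓ)
    (hBL : B ≤ a * L) (hQ0 : 0 ≤ Q) (hN : N ≤ 2 * (28 * B / (δ * ε)))
    (hQ : Q ≤ 40 * (k / ε) * (b * ℓ)) :
    2 * N * Q ≤ 4480 * a * b / (δ * ℓ₀) * (k / ε ^ 2 * L ^ 2 * ℓ) := by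
  have hL0 : 0 < L := hℓ₀.trans_le hL
  calc 2 * N * Q ≤ 2 * (2 * (28 * (a * L) / (δ * ε))) * Q := by
        gcongr
        exact hN.trans (by gcongr)
    _ ≤ 2 * (2 * (28 * (a * L) / (δ * ε))) * (40 * (k / ε) * (b * ℓ)) := by gcongr
    _ = 4480 * a * b / δ * (k / ε ^ 2 * L * ℓ) * 1 := by field_simp; ring
    _ ≤ 4480 * a * b / δ * (k / ε ^ 2 * L * ℓ) * (L / ℓ₀) := by
        gcongr
        rwa [one_le_div hℓ₀]
    _ = _ := by field_simp

end QPP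

/-! ### The two estimators -/

theorem corollary3 :
    ∀ ε₀ δ : ℝ, 0 < ε₀ → ε₀ < 1 → 0 < δ → δ < 1 →
    ∃ C : ℝ, 0 < C ∧
    ∀ (n n' κ : ℕ) (ε : ℝ), 1 ≤ κ → κ ≤ 2 ^ n → 0 < ε → ε ≤ ε₀ →
    ∃ (w : ℕ) (c : QPP.Circuit (Fin 2 × QPP.Reg w) (QPP.Reg n × QPP.Reg n')),
      -- repeated measurement of the single qubit
      (∃ (M : ℕ) (est : (Fin M → Fin 2) → ℝ),
        ((M * QPP.Circuit.queries c : ℕ) : ℝ)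
            ≤ C * (κ / ε ^ 3 * Real.log (κ / ε) ^ 3 * Real.log (1 / ε)) ∧
        ∀ (ρ : Matrix (QPP.Reg n) (QPP.Reg n) ℂ)
          (U : Matrix.unitaryGroup (QPP.Reg n × QPP.Reg n') ℂ),
          QPP.IsDensityMatrix ρ → ρ.rank = κ → QPP.IsPurifiedOracle U ρ →
          1 - δ ≤ QPP.iidProb M (QPP.outcomeProb c U)
            (fun x => |est x - QPP.vonNeumannEntropy ρ| ≤ ε)) ∧
      -- amplitude estimation of the probability of that measurement
      (∃ (t M : ℕ) (est : (Fin M → QPP.Reg t) → ℝ),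
        ((M * QPP.Circuit.queries (QPP.amplitudeEstimation t c) : ℕ) : ℝ)
            ≤ C * (κ / ε ^ 2 * Real.log (κ / ε) ^ 2 * Real.log (1 / ε)) ∧
        ∀ (ρ : Matrix (QPP.Reg n) (QPP.Reg n) ℂ)
          (U : Matrix.unitaryGroup (QPP.Reg n × QPP.Reg n') ℂ),
          QPP.IsDensityMatrix ρ → ρ.rank = κ → QPP.IsPurifiedOracle U ρ →
          1 - δ ≤ QPP.iidProb M (QPP.outcomeProb (QPP.amplitudeEstimation t c) U)
            (fun x => |est x - QPP.vonNeumannEntropy ρ| ≤ ε)) := by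

  intro ε₀ δ hε₀ hε₀1 hδ hδ1
  set ℓ₀ := Real.log (1 / ε₀) with hℓ₀
  have hℓ₀0 : 0 < ℓ₀ := Real.log_pos (by rw [lt_div_iff₀ hε₀]; linarith)
  have hlog4 : 1 < Real.log 4 := by
    rw [Real.lt_log_iff_exp_lt (by norm_num)]
    linarith [Real.exp_one_lt_d9]
  -- The constants `a` and `b` absorb additive terms: `log 4 + L ≤ a L` and `ℓ + 2 ≤ b ℓ`, because
  -- `ℓ₀ ≤ ℓ ≤ L`.
  set a := 1 + Real.log 4 / ℓ₀ with ha
  set b := 1 + 2 / ℓ₀ with hb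
  have ha0 : 0 < a := by positivity
  have hb0 : 0 < b := by positivity
  have hC1 : 0 < 320 * a ^ 2 * b / (δ * ℓ₀) := by positivity
  have hC2 : 0 < 4480 * a * b / (δ * ℓ₀) := by positivity
  refine ⟨320 * a ^ 2 * b / (δ * ℓ₀) + 4480 * a * b / (δ * ℓ₀), add_pos hC1 hC2, ?_⟩
  intro n n' κ ε hκ _ hε hεε₀
  have hε1 : ε < 1 := hεε₀.trans_lt hε₀1
  have hκ1 : (1 : ℝ) ≤ κ := by exact_mod_cast hκ
  set ℓ := Real.log (1 / ε) with hℓ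
  set L := Real.log (κ / ε) with hL
  have hℓℓ₀ : ℓ₀ ≤ ℓ := Real.log_le_log (by positivity) (by gcongr)
  have hℓL : ℓ ≤ L := Real.log_le_log (by positivity) (by gcongr)
  have hℓ0 : 0 < ℓ := hℓ₀0.trans_le hℓℓ₀
  have hL0 : 0 < L := hℓ0.trans_le hℓL
  obtain ⟨w, c, Λ, hΛ0, hΛB, hQ, hS⟩ := QPP.exists_entropy_circuit n n' κ ε hκ hε hε1
  set B := Real.log (4 * κ / ε) with hB
  have hBeq : B = Real.log 4 + L := by
    rw [hB, hL, mul_div_assoc, Real.log_mul (by norm_num) (by positivity)]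
  have hB1 : 1 < B := by linarith
  have hBL : B ≤ a * L := by
    have : Real.log 4 ≤ Real.log 4 / ℓ₀ * L := by
      rw [div_mul_eq_mul_div, le_div_iff₀ hℓ₀0]
      gcongr
      linarith
    rw [hBeq, ha]
    linarith
  have hQ' : (QPP.Circuit.queries c : ℝ) ≤ 40 * (κ / ε) * (b * ℓ) := by
    have : 2 ≤ 2 / ℓ₀ * ℓ := by
      rw [div_mul_eq_mul_div, le_div_iff₀ hℓ₀0]
      gcongr
    refine hQ.trans ?_
    gcongr
    rw [hb]
    linarith
  have hη : 0 < ε / (4 * B) := by positivity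
  refine ⟨w, c, ?_, ?_⟩
  -- Chebyshev's inequality with precision `η = ε / (4B)` fails with probability at most `1 / (4Mη²)
  -- = 4B² / (Mε²)`, which fixes `M`. As the bound is at least 1, rounding up at most doubles it.
  · have hX : 1 ≤ 4 * B ^ 2 / (δ * ε ^ 2) := by
      rw [one_le_div (by positivity)]
      have : δ * ε ^ 2 ≤ 1 := by nlinarith
      nlinarith
    have hM1 := Nat.le_ceil (4 * B ^ 2 / (δ * ε ^ 2))
    have hM2 := (Nat.ceil_lt_add_one (by positivity : 0 ≤ 4 * B ^ 2 / (δ * ε ^ 2))).le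
    set M := ⌈4 * B ^ 2 / (δ * ε ^ 2)⌉₊ with hM
    have hM0 : (0 : ℝ) < M := by linarith
    refine ⟨M, fun x => Real.log 2 + Λ * (1 - 2 * ((∑ i, ((x i : ℕ) : ℝ)) / M)), ?_, ?_⟩
    · push_cast
      refine (QPP.sampling_cost_le hℓ₀0 hδ hε (Nat.cast_nonneg κ) hb0.le (hℓℓ₀.trans hℓL) hℓ0.le
        (by linarith) hBL (Nat.cast_nonneg _) (hM2.trans ?_) hQ').trans ?_
      · rw [show 8 * B ^ 2 / (δ * ε ^ 2)
          = 4 * B ^ 2 / (δ * ε ^ 2) + 4 * B ^ 2 / (δ * ε ^ 2) by ring]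
        linarith
      · gcongr
        linarith
    · intro ρ U hρ hrank hU
      have hch := QPP.iidProb_frequency (QPP.outcomeProb c U) (QPP.outcomeProb_nonneg c U)
        (QPP.sum_outcomeProb c U) M (by exact_mod_cast hM0) (ε / (4 * B)) hη
      have hδM : 1 / (4 * M * (ε / (4 * B)) ^ 2) ≤ δ := by
        rw [div_le_iff₀ (by positivity)]
        rw [div_le_iff₀ (by positivity)] at hM1
        have : δ * (4 * M * (ε / (4 * B)) ^ 2) = M * (δ * ε ^ 2) / (4 * B ^ 2) := by
          field_simp
        rw [this, le_div_iff₀ (by positivity)]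
        linarith
      refine le_trans (by linarith) (hch.trans (QPP.iidProb_mono M _ (QPP.outcomeProb_nonneg c U)
        fun x hx => ?_))
      exact QPP.abs_estimate_sub_le hΛ0 hΛB (by linarith) hε (hS ρ U hρ hrank hU) hx
  -- With `η = ε / (4B)` the failure bound `7 / (2 ^ t η)` equals `28B / (2 ^ t ε)`, which is at
  -- most `δ` for this `t`. A single run is therefore enough.
  · obtain ⟨t, ht1, ht2⟩ := QPP.exists_two_pow_between (28 * B / (δ * ε)) (by
      rw [one_le_div (by positivity)]
      nlinarith)
    have hN : 7 / δ ≤ 2 ^ t * (ε / (4 * B)) := by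
      calc 7 / δ = 28 * B / (δ * ε) * (ε / (4 * B)) := by field_simp; norm_num
        _ ≤ _ := by gcongr
    have h7 : 7 ≤ 7 / δ := by
      rw [le_div_iff₀ hδ]
      linarith
    refine ⟨t, 1, fun x => Real.log 2
      + Λ * (1 - 2 * Real.sin (Real.pi * ((x 0 : Fin (2 ^ t)) : ℕ) / 2 ^ t) ^ 2), ?_, ?_⟩
    · have hcost : ((1 * QPP.Circuit.queries (QPP.amplitudeEstimation t c) : ℕ) : ℝ)
          ≤ 2 * 2 ^ t * (QPP.Circuit.queries c : ℝ) := by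
        rw [QPP.queries_amplitudeEstimation, one_mul, Nat.cast_add, Nat.cast_mul,
          Nat.cast_sub Nat.one_le_two_pow]
        push_cast
        have : (0 : ℝ) ≤ QPP.Circuit.queries c := Nat.cast_nonneg _
        linarith
      refine hcost.trans ((QPP.amplitude_cost_le hℓ₀0 hδ hε (Nat.cast_nonneg κ) ha0.le hb0.le
        (hℓℓ₀.trans hℓL) hℓ0.le hBL (Nat.cast_nonneg _) ht2 hQ').trans ?_)
      gcongr
      linarith
    · intro ρ U hρ hrank hU
      have hae := QPP.amplitudeEstimation_concentration U t c (ε / (4 * B)) hη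
        (by linarith [Real.pi_lt_four])
      have hδN : 7 / (2 ^ t * (ε / (4 * B))) ≤ δ := by
        rw [div_le_iff₀ (by positivity)]
        rw [div_le_iff₀ hδ] at hN
        linarith
      rw [← QPP.iidProb_one] at hae
      refine le_trans (by linarith) (hae.trans (QPP.iidProb_mono 1 _
        (QPP.outcomeProb_nonneg _ U) fun x hx => ?_))
      exact QPP.abs_estimate_sub_le hΛ0 hΛB (by linarith) hε (hS ρ U hρ hrank hU) hx
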